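/- Let $\mathcal G=(\mathcal V,\mathcal E,w)$ be a connected undirected graph with $n\ge 2$ nodes and positive link weights, with weighted adjacency matrix $A$, diagonal matrix $\Delta$ of weighted degrees, Laplacian $L=\Delta-A$ with eigenvalues $0=\lambda_1\le\dots\le\lambda_n$ and an orthonormal basis $q_1,\dots,q_n$ of eigenvectors, signed incidence matrix $E$ (for any orientation) and diagonal matrix $W$ of link weights; let $M=I-\frac1n\mathbf 1\mathbf 1^{T}$. For a delay $\tau\ge 0$ consider $$\dot x(t)=-L\,x(t-\tau)+B\,\xi(t),\qquad y(t)=M\,x(t),$$ with $x(t)=0$ on $[-\tau,0)$ and $x(0)=x^0$ deterministic, where $\xi_k$ are independent zero-mean Gaussian white noises of intensities $\sigma_k^2\ge 0$ (that is, $\xi_k=\sigma_k\,dW_k/dt$ with independent standard Brownian motions $W_k$), indexed either by the nodes ($B\in\mathbb R^{\mathcal V\times\mathcal V}$) or by the links ($B\in\mathbb R^{\mathcal V\times\mathcal E}$). Put $\rho_{ss}=\lim_{t\to\infty}\mathbb E[y(t)^Ty(t)]$, and define the node centrality indices $\eta_i=\partial\rho_{ss}/\partial\sigma_i^2$ (noise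 indexed by nodes) and the link centrality indices $\nu_e=\partial\rho_{ss}/\partial\sigma_e^2$ (noise indexed by links); at $\sigma_k^2=0$ the derivative is one-sided. Then in the stability region $\{\tau\ge 0:\tau\lambda_n<\pi/2\}$ the second moments of $y$ are finite, the limit $\rho_{ss}$ and these partial derivatives exist, and, for all fixed values of the variances, each index $\eta_i$ (resp. $\nu_e$) is differentiable in $\tau$ (from the right at $\tau=0$) with derivative $$\frac12\sum_{j=1}^{n}\frac{(q_j^{T}Mb)^2}{1-\sin(\lambda_j\tau)}\ \ge 0,$$ where $b$ is the column of $B$ belonging to the node $i$ (resp. the link $e$); hence the index is nondecreasing in $\tau$. If $b$ is not a multiple of $\mathbf 1$, this derivative is positive and the index is strictly increasing in $\tau$ on the stability region. In particular, $\eta_i$ is strictly increasing for every node $i$ when $B\in\{I,\,L,\,\Delta,\,A\}$ (dynamics, sensor, receiver and emitter noise), and $\nu_e$ is strictly increasing for every link $e$ when $B\in\{EW,\,-E\}$ (communication channel and measurement noise). -/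

import Mathlib

open MeasureTheory ProbabilityTheory Filter Topology
open scoped NNReal

universe u

/-! ### Weighted graphs and their matrices -/

section Matrices

variable {V : Type*} [Fintype V] [DecidableEq V]

/-- Adjacency matrix `A` of the graph `G` with edge weights `w` (only the values of `w` on the edges
of `G` are used). -/
def wAdj (G : SimpleGraph V) [DecidableRel G.Adj] (w : Sym2 V → ℝ) : Matrix V V ℝ :=
  Matrix.of fun i j => if G.Adj i j then w s(i, j) else 0

/-- Diagonal matrix `Δ` of the weighted node degrees. -/
def wDeg (G : SimpleGraph V) [DecidableRel G.Adj] (w : Sym2 V → ℝ) : Matrix V V ℝ :=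
  Matrix.diagonal fun i => ∑ j, wAdj G w i j

/-- Weighted Laplacian `L = Δ - A`. -/
def wLap (G : SimpleGraph V) [DecidableRel G.Adj] (w : Sym2 V → ℝ) : Matrix V V ℝ :=
  wDeg G w - wAdj G w

theorem wLap_isHermitian (G : SimpleGraph V) [DecidableRel G.Adj] (w : Sym2 V → ℝ) :
    (wLap G w).IsHermitian := by
  refine Matrix.IsHermitian.sub (Matrix.isHermitian_diagonal _) ?_
  ext i j
  simp [wAdj, Matrix.conjTranspose_apply, G.adj_comm i j, Sym2.eq_swap]

/-- Signed vertex-edge incidence matrix of `G`, for the orientation in which the edge `e` has head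
`hd e` and tail `tl e`. -/
def incidence (G : SimpleGraph V) (hd tl : G.edgeSet → V) : Matrix V G.edgeSet ℝ :=
  Matrix.of fun i e => if i = hd e then 1 else if i = tl e then -1 else 0

/-- Diagonal matrix of the edge weights. -/
def weightMat (G : SimpleGraph V) (w : Sym2 V → ℝ) : Matrix G.edgeSet G.edgeSet ℝ :=
  Matrix.diagonal fun e => w e

variable (V) in
/-- Centering matrix `M = I - (1/n) J`. -/
noncomputable def centering : Matrix V V ℝ :=
  1 - (Fintype.card V : ℝ)⁻¹ • Matrix.of fun _ _ => 1

/-- The delays `τ ≥ 0` with `τ λ_n < π/2`, where `λ_n` is the largest Laplacian eigenvalue. -/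
def stabilityRegion (G : SimpleGraph V) [DecidableRel G.Adj] (w : Sym2 V → ℝ) : Set ℝ :=
  {τ | 0 ≤ τ ∧ ∀ j, τ * (wLap_isHermitian G w).eigenvalues j < Real.pi / 2}

/-- The quantity `1/2 ∑_j (q_jᵀ M b)² / (1 - sin (λ_j τ))`, where `(q_j)` is an orthonormal basis of
eigenvectors of the Laplacian with eigenvalues `λ_j`. -/
noncomputable def spectralSlope (G : SimpleGraph V) [DecidableRel G.Adj] (w : Sym2 V → ℝ)
    (b : V → ℝ) (τ : ℝ) : ℝ :=
  (1 / 2) * ∑ j, (∑ i, (wLap_isHermitian G w).eigenvectorBasis j i * (centering V).mulVec b i) ^ 2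
    / (1 - Real.sin ((wLap_isHermitian G w).eigenvalues j * τ))

end Matrices

/-! ### Noisy consensus networks with delay -/

section Networks

variable {V K : Type*} [Fintype V] [DecidableEq V] [Fintype K] [DecidableEq K]

/-- `x` is a solution of the stochastic delay equation
`dx(t) = -L x(t - τ) dt + ∑_k b_k √(v_k) dW_k(t)`, where `b_k` are the columns of `B`, with
`x(t) = 0` for `t ∈ [-τ, 0)` and `x(0) = x₀`. The noise is additive, so the equation is understood
in integrated form, path by path. -/
structure IsDelaySolution {Ω : Type u} [MeasurableSpace Ω] (P : Measure Ω)
    (L : Matrix V V ℝ) (B : Matrix V K ℝ) (x₀ : V → ℝ) (W : K → ℝ≥0 → Ω → ℝ)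
    (τ : ℝ) (v : K → ℝ) (x : ℝ → Ω → V → ℝ) : Prop where
  measurable : ∀ t, Measurable (x t)
  continuousOn : ∀ᵐ ω ∂P, ContinuousOn (fun t => x t ω) (Set.Ici 0)
  history : ∀ᵐ ω ∂P, ∀ t ∈ Set.Ico (-τ) 0, x t ω = 0
  equation : ∀ᵐ ω ∂P, ∀ t, 0 ≤ t → ∀ i,
    x t ω i = x₀ i - (∫ s in (0 : ℝ)..t, L.mulVec (x (s - τ) ω) i)
      + ∑ k, B i k * (√(v k) * W k t.toNNReal ω)

/-- The consensus network `ẋ(t) = -L x(t - τ) + B ξ(t)`, `y(t) = M x(t)`, where the `ξ_k` are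
independent zero-mean Gaussian white noises of variance (intensity) `v_k = σ_k²`: the noises are
realized as `ξ_k = σ_k dW_k/dt` for independent standard Brownian motions `W_k`, and `x τ v` is the
state of the network for the delay `τ` and the variances `v`. -/
structure NoisyNetwork (L : Matrix V V ℝ) (B : Matrix V K ℝ) where
  /-- sample space -/
  Ω : Type u
  [mΩ : MeasurableSpace Ω]
  /-- probability measure -/
  P : Measure Ω
  [isProb : IsProbabilityMeasure P]
  /-- driving Brownian motions -/
  W : K → ℝ≥0 → Ω → ℝ
  brownian : ∀ k, IsBrownianReal (W k) P
  indep : iIndepFun (fun k ω t => W k t ω) P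
  /-- initial condition -/
  x₀ : V → ℝ
  /-- state -/
  x : ℝ → (K → ℝ) → ℝ → Ω → V → ℝ
  solution : ∀ τ v, 0 ≤ τ → (∀ k, 0 ≤ v k) → IsDelaySolution P L B x₀ W τ v (x τ v)

namespace NoisyNetwork

variable {L : Matrix V V ℝ} {B : Matrix V K ℝ}

attribute [instance] mΩ isProb

/-- `y(t)ᵀ y(t)` for the output `y(t) = M x(t)`. -/
noncomputable def outputSq (N : NoisyNetwork.{u} L B) (τ : ℝ) (v : K → ℝ) (t : ℝ) (ω : N.Ω) : ℝ :=
  (centering V).mulVec (N.x τ v t ω) ⬝ᵥ (centering V).mulVec (N.x τ v t ω)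

/-- Performance `ρ_ss = lim_{t → ∞} E[y(t)ᵀ y(t)]`. -/
noncomputable def performance (N : NoisyNetwork.{u} L B) (τ : ℝ) (v : K → ℝ) : ℝ :=
  limUnder atTop fun t : ℝ => ∫ ω, N.outputSq τ v t ω ∂N.P

/-- Centrality index of the noise channel `k`: the partial derivative `∂ρ_ss/∂σ_k²` at the
variances `v` (one-sided if `v k = 0`, since variances are nonnegative). For channels indexed by the
nodes this is `η_k`, for channels indexed by the links it is `ν_k`. -/
noncomputable def centrality (N : NoisyNetwork.{u} L B) (k : K) (v : K → ℝ) (τ : ℝ) : ℝ :=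
  derivWithin (fun s => N.performance τ (Function.update v k s)) (Set.Ici 0) (v k)

/-- The centrality indices are well defined for the delay `τ` and the variances `v`: the second
moments of the output are finite, the limit defining the performance exists, and the performance has
a partial derivative with respect to the variance of every noise channel. -/
structure WellPosed (N : NoisyNetwork.{u} L B) (τ : ℝ) (v : K → ℝ) : Prop where
  integrable : ∀ t, 0 ≤ t → Integrable (N.outputSq τ v t) N.P
  tendsto : Tendsto (fun t : ℝ => ∫ ω, N.outputSq τ v t ω ∂N.P) atTop (𝓝 (N.performance τ v))
  differentiable : ∀ k, DifferentiableWithinAt ℝ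
    (fun s => N.performance τ (Function.update v k s)) (Set.Ici 0) (v k)

end NoisyNetwork

end Networks

/-! ### Functions that are continuous from a point on and vanish before it -/

/-! An orthonormal eigenbasis `q_j` of `L` decouples the network: the mode `z = q_j · x` solves a
scalar equation `z' = -λ_j z(t - τ) + noise` whose noise has intensity `∑ v_k (q_j · b_k)²`. The
noise is additive, so the integrated equation can be solved path by path: variation of constants
(`representation`) writes `z(t)` as an ordinary integral against the Brownian path, and no
stochastic integral is needed. Fubini with the covariance `min s s'` then gives `E z(t)² = z(0)²
Φ(t)² + intensity * ∫₀ᵗ Φ²`, where `Φ` is the fundamental solution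
(`integral_sq_response_const_add_noise`).

The core is the value of `∫ Φ²` over `[0, ∞)`. Scaling time reduces it to rate 1 and delay `δ = λτ`.
Put `A = cos δ / (2 (1 - sin δ))` and `U(s) = A cos s - (1/2) sin s`. The form `A z(t)² - 2 z(t) ∫
U(q - t + δ) z(q) dq + ∬ U(|q - q'|) z(q) z(q') dq dq'`, with integrals over `[t - δ, t]`, is a
Lyapunov–Krasovskii functional (`functional`): along the fundamental solution it starts at `A` and
has derivative `-z(t)²`. For `δ < π/2` it is nonnegative, which rests on the positivity of the
kernel `sin (min) cos (max)` (`sweptArea_le_mul`). Hence `∫ z² ≤ A`; this forces `z → 0`, so the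
functional tends to zero and the integral equals `A` (`tendsto_of_unit_rate`).

The centering `M` kills the modes of eigenvalue zero, which are constant vectors by connectedness,
and leaves the coefficients along the others unchanged. So `ρ_ss` is linear in the variances, each
index is `∑ (q_j · M b)² * modalGain λ_j τ`, and the derivative of `modalGain` simplifies to `1 / (2
(1 - sin (λτ)))`. If `b` is not constant, Parseval provides a mode with nonzero weight. -/

/-- `f` vanishes before some point and agrees with a continuous function from there on. -/
def CutContinuous (f : ℝ → ℝ) : Prop :=
  ∃ (a : ℝ) (g : ℝ → ℝ), Continuous g ∧ f = (Set.Ici a).indicator g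

namespace CutContinuous

variable {f : ℝ → ℝ}

theorem measurable (hf : CutContinuous f) : Measurable f := by
  obtain ⟨a, g, hg, rfl⟩ := hf
  exact hg.measurable.indicator measurableSet_Ici

theorem intervalIntegrable (hf : CutContinuous f) (x y : ℝ) :
    IntervalIntegrable f volume x y := by
  obtain ⟨a, g, hg, rfl⟩ := hf
  have := hg.intervalIntegrable (μ := volume) x y
  rw [intervalIntegrable_iff] at this ⊢
  exact this.indicator measurableSet_Ici

theorem continuousWithinAt (hf : CutContinuous f) (t : ℝ) :
    ContinuousWithinAt f (Set.Ici t) t := by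
  obtain ⟨a, g, hg, rfl⟩ := hf
  rcases lt_or_ge t a with h | h
  · have : (Set.Ici a).indicator g =ᶠ[𝓝 t] fun _ => 0 := by
      filter_upwards [Iio_mem_nhds h] with x hx
      exact Set.indicator_of_notMem (by simpa using hx) _
    exact (continuousAt_const.congr this.symm).continuousWithinAt
  · refine hg.continuousWithinAt.congr (fun x hx => ?_) ?_
    · exact Set.indicator_of_mem (h.trans hx) _
    · exact Set.indicator_of_mem h _

theorem continuous_mul (hf : CutContinuous f) {h : ℝ → ℝ} (hh : Continuous h) :
    CutContinuous fun t => h t * f t := by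
  obtain ⟨a, g, hg, rfl⟩ := hf
  refine ⟨a, fun t => h t * g t, hh.mul hg, ?_⟩
  ext t
  simp only [Set.indicator_apply]
  split_ifs <;> simp

theorem sq (hf : CutContinuous f) : CutContinuous fun t => f t ^ 2 := by
  obtain ⟨a, g, hg, rfl⟩ := hf
  refine ⟨a, fun t => g t ^ 2, hg.pow 2, ?_⟩
  ext t
  simp only [Set.indicator_apply]
  split_ifs <;> simp

theorem comp_sub (hf : CutContinuous f) (d : ℝ) : CutContinuous fun t => f (t - d) := by
  obtain ⟨a, g, hg, rfl⟩ := hf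
  refine ⟨a + d, fun t => g (t - d), by fun_prop, ?_⟩
  ext t
  simp only [Set.indicator_apply, Set.mem_Ici, le_sub_iff_add_le]

theorem of_continuousOn (hf : ContinuousOn f (Set.Ici 0)) (h0 : ∀ t < 0, f t = 0) :
    CutContinuous f := by
  refine ⟨0, fun t => f (max t 0), ?_, ?_⟩
  · exact hf.comp_continuous (by fun_prop) (fun t => Set.mem_Ici.2 (le_max_right _ _))
  · ext t
    by_cases h : 0 ≤ t
    · simp [h]
    · rw [Set.indicator_of_notMem (by simpa using h), h0 t (by simpa using h)]

/-- At its cut such a function may jump but is right-continuous, so its primitive has a right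
derivative at every point. This lets the energy argument use right derivatives without exceptional
times. -/
theorem hasDerivWithinAt_integral (hf : CutContinuous f) (t : ℝ) :
    HasDerivWithinAt (fun u => ∫ q in (0 : ℝ)..u, f q) (f t) (Set.Ici t) t :=
  intervalIntegral.integral_hasDerivWithinAt_right (hf.intervalIntegrable 0 t)
    (t := Set.Ioi t) (hf.measurable.stronglyMeasurable.stronglyMeasurableAtFilter)
    ((hf.continuousWithinAt t).mono Set.Ioi_subset_Ici_self)

theorem continuous_integral (hf : CutContinuous f) :
    Continuous fun u => ∫ q in (0 : ℝ)..u, f q :=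
  intervalIntegral.continuous_primitive hf.intervalIntegrable 0

end CutContinuous

/-! ### The fundamental solution of the scalar delay equation -/

/-- `Φ` is the fundamental solution of `Φ'(t) = -c Φ(t - δ)`: it vanishes for `t < 0`, and
`Φ(0) = 1`. -/
structure IsFundamentalSolution (c δ : ℝ) (Φ : ℝ → ℝ) : Prop where
  neg : ∀ t < 0, Φ t = 0
  continuousOn : ContinuousOn Φ (Set.Ici 0)
  equation : ∀ t, 0 ≤ t → Φ t = 1 - c * ∫ s in (0 : ℝ)..t, Φ (s - δ)

/-- The fundamental solution of `Φ'(t) = -c Φ(t - δ)`, as a series. -/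
noncomputable def fundamentalSolution (c δ t : ℝ) : ℝ :=
  if t < 0 then 0 else ∑' k : ℕ, (-c) ^ k * (max (t - k * δ) 0 ^ k / k.factorial)

theorem norm_fundamentalSolution_term_le {c δ t T : ℝ} (hδ : 0 ≤ δ) (ht : t ≤ T) (hT : 0 ≤ T)
    (k : ℕ) :
    ‖(-c) ^ k * (max (t - k * δ) 0 ^ k / k.factorial)‖ ≤ (|c| * T) ^ k / k.factorial := by
  have h1 : |max (t - k * δ) 0| ≤ T := by
    rw [abs_of_nonneg (le_max_right _ _)]
    refine max_le ?_ hT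
    have : 0 ≤ (k : ℝ) * δ := by positivity
    linarith
  rw [Real.norm_eq_abs, abs_mul, abs_div, abs_pow, abs_pow, abs_neg, mul_pow, mul_div_assoc,
    Nat.abs_cast]
  gcongr

theorem fundamentalSolution_of_nonneg {c δ t : ℝ} (ht : 0 ≤ t) :
    fundamentalSolution c δ t = ∑' k : ℕ, (-c) ^ k * (max (t - k * δ) 0 ^ k / k.factorial) :=
  if_neg ht.not_gt

theorem hasSum_fundamentalSolution {c δ t : ℝ} (hδ : 0 ≤ δ) (ht : 0 ≤ t) :
    HasSum (fun k : ℕ => (-c) ^ k * (max (t - k * δ) 0 ^ k / k.factorial))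
      (fundamentalSolution c δ t) := by
  rw [fundamentalSolution_of_nonneg ht]
  exact (Summable.of_norm_bounded (Real.summable_pow_div_factorial (|c| * t))
    (norm_fundamentalSolution_term_le hδ le_rfl ht)).hasSum

theorem continuousOn_fundamentalSolution {c δ : ℝ} (hδ : 0 ≤ δ) :
    ContinuousOn (fundamentalSolution c δ) (Set.Ici 0) := by
  intro t ht
  have hT : (0 : ℝ) ≤ t + 1 := by linarith [Set.mem_Ici.1 ht]
  have h : ContinuousOn
      (fun x => ∑' k : ℕ, (-c) ^ k * (max (x - k * δ) 0 ^ k / k.factorial)) (Set.Iic (t + 1)) := by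
    refine continuousOn_tsum (fun k => ?_) (Real.summable_pow_div_factorial (|c| * (t + 1)))
      (fun k x hx => norm_fundamentalSolution_term_le hδ hx hT k)
    exact Continuous.continuousOn (by fun_prop)
  have h2 := (h.continuousAt (Iic_mem_nhds (by linarith : t < t + 1))).continuousWithinAt
    (s := Set.Ici 0)
  exact h2.congr (fun x hx => fundamentalSolution_of_nonneg hx) (fundamentalSolution_of_nonneg ht)

/-- The guard `s < a` only matters for `k = 0`, where `0 ^ 0 = 1` would make the integrand equal to
1 before `a`. -/
theorem integral_max_pow {a : ℝ} (ha : 0 ≤ a) (t : ℝ) (k : ℕ) :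
    ∫ s in (0 : ℝ)..t, (if s < a then 0 else max (s - a) 0 ^ k / k.factorial)
      = max (t - a) 0 ^ (k + 1) / (k + 1).factorial := by
  have hm : Measurable fun s : ℝ => if s < a then (0 : ℝ) else max (s - a) 0 ^ k / k.factorial :=
    Measurable.ite measurableSet_Iio measurable_const (by fun_prop)
  have hzero : ∀ u, u ≤ a →
      ∫ s in (0 : ℝ)..u, (if s < a then (0 : ℝ) else max (s - a) 0 ^ k / k.factorial) = 0 := by
    intro u hu
    refine intervalIntegral.integral_zero_ae ?_
    filter_upwards [(measure_eq_zero_iff_ae_notMem (s := {a})).1 Real.volume_singleton] with s hs hsu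
    refine if_pos (lt_of_le_of_ne ?_ hs)
    rcases Set.mem_uIoc.1 hsu with h | h <;> linarith [h.1, h.2]
  rcases le_total t a with h | h
  · rw [hzero t h, max_eq_right (by linarith)]
    simp
  · have hint : ∀ x y, a ≤ x → a ≤ y → Set.EqOn (fun s : ℝ => max (s - a) 0 ^ k / k.factorial)
        (fun s : ℝ => if s < a then (0 : ℝ) else max (s - a) 0 ^ k / k.factorial)
        (Set.uIcc x y) := by
      intro x y hx hy s hs
      have : a ≤ s := (le_min hx hy).trans hs.1
      simp [this.not_gt]
    have hi1 : IntervalIntegrable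
        (fun s : ℝ => if s < a then (0 : ℝ) else max (s - a) 0 ^ k / k.factorial) volume 0 a := by
      refine (intervalIntegrable_const (c := (0 : ℝ))).congr_ae ?_
      filter_upwards [ae_restrict_mem measurableSet_uIoc,
        ae_restrict_of_ae ((measure_eq_zero_iff_ae_notMem (s := {a})).1 Real.volume_singleton)]
        with s hs hsa
      rw [Set.uIoc_of_le ha] at hs
      exact (if_pos (lt_of_le_of_ne hs.2 hsa)).symm
    have hi2 : IntervalIntegrable
        (fun s : ℝ => if s < a then (0 : ℝ) else max (s - a) 0 ^ k / k.factorial) volume a t :=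
      IntervalIntegrable.congr ((hint a t le_rfl h).mono Set.uIoc_subset_uIcc)
        (Continuous.intervalIntegrable (by fun_prop) _ _)
    rw [← intervalIntegral.integral_add_adjacent_intervals hi1 hi2, hzero a le_rfl, zero_add,
      ← intervalIntegral.integral_congr (hint a t le_rfl h),
      intervalIntegral.integral_congr (g := fun s => (s - a) ^ k / (k.factorial : ℝ)) (fun s hs => by
        rw [Set.uIcc_of_le h] at hs
        simp only
        rw [max_eq_left (by linarith [hs.1])]),
      intervalIntegral.integral_div,
      intervalIntegral.integral_comp_sub_right (fun s => s ^ k) a, integral_pow,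
      max_eq_left (by linarith), Nat.factorial_succ]
    push_cast
    field_simp
    simp

theorem isFundamentalSolution_fundamentalSolution {c δ : ℝ} (hδ : 0 ≤ δ) :
    IsFundamentalSolution c δ (fundamentalSolution c δ) where
  neg t ht := if_pos ht
  continuousOn := continuousOn_fundamentalSolution hδ
  equation t ht := by
    have h1 : HasSum (fun k : ℕ => ∫ s in (0 : ℝ)..t, (if s < δ then 0 else
        (-c) ^ k * (max (s - δ - k * δ) 0 ^ k / k.factorial)))
        (∫ s in (0 : ℝ)..t, fundamentalSolution c δ (s - δ)) := by
      refine intervalIntegral.hasSum_integral_of_dominated_convergence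
        (fun k _ => (|c| * t) ^ k / k.factorial) (fun k => ?_) (fun k => ?_) ?_ ?_ ?_
      · refine Measurable.aestronglyMeasurable ?_
        exact Measurable.ite measurableSet_Iio measurable_const (by fun_prop)
      · refine ae_of_all _ fun s hs => ?_
        rw [Set.uIoc_of_le ht] at hs
        split_ifs
        · simp only [norm_zero]; positivity
        · exact norm_fundamentalSolution_term_le hδ (by linarith [hs.2]) ht k
      · exact ae_of_all _ fun s hs => Real.summable_pow_div_factorial _
      · simp
      · refine ae_of_all _ fun s hs => ?_
        by_cases h : s < δ
        · simp [h, fundamentalSolution]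
        · simp only [h, if_false]
          exact hasSum_fundamentalSolution hδ (by linarith)
    have h2 : ∀ k : ℕ, ∫ s in (0 : ℝ)..t, (if s < δ then 0 else
        (-c) ^ k * (max (s - δ - k * δ) 0 ^ k / k.factorial))
        = (-c) ^ k * (max (t - (k + 1 : ℕ) * δ) 0 ^ (k + 1) / (k + 1).factorial) := by
      intro k
      rw [← integral_max_pow (by positivity), ← intervalIntegral.integral_const_mul]
      refine intervalIntegral.integral_congr fun s _ => ?_
      have h3 : s - δ - k * δ = s - (k + 1 : ℕ) * δ := by push_cast; ring
      simp only [h3]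
      rcases lt_or_ge s δ with h | h
      · have : s < (k + 1 : ℕ) * δ := by push_cast; nlinarith [Nat.cast_nonneg (α := ℝ) k]
        rw [if_pos h, if_pos this, mul_zero]
      · rw [if_neg h.not_gt]
        split_ifs with h4
        · have hk : k ≠ 0 := by
            rintro rfl
            simp at h4
            linarith
          rw [max_eq_right (by linarith)]
          simp [hk]
        · rfl
    simp_rw [h2] at h1
    have h3 := hasSum_fundamentalSolution (c := c) hδ ht
    -- The term `k = 0` is the initial value 1. The remaining series is `-c` times the termwise
    -- integral, since integrating term `k` after the delay produces term `k + 1` without its last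
    -- factor `-c`.
    rw [← hasSum_nat_add_iff' 1] at h3
    have h4 := h1.mul_left (-c)
    have h5 := h3.unique (h4.congr_fun fun k => by ring)
    simp only [Finset.range_one, Finset.sum_singleton, pow_zero, CharP.cast_eq_zero,
      Nat.factorial_zero, Nat.cast_one, div_one, mul_one] at h5
    linarith

/-! ### The energy functional of the delay equation -/

theorem le_of_hasDerivWithinAt_right_nonneg {F F' : ℝ → ℝ} {a b : ℝ} (hab : a ≤ b)
    (hF : ContinuousOn F (Set.Icc a b))
    (hF' : ∀ x ∈ Set.Ico a b, HasDerivWithinAt F (F' x) (Set.Ici x) x)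
    (h0 : ∀ x ∈ Set.Ico a b, 0 ≤ F' x) : F a ≤ F b :=
  image_le_of_deriv_right_le_deriv_boundary (f := fun _ => F a) (f' := fun _ => 0)
    continuousOn_const (fun _ _ => hasDerivWithinAt_const _ _ _) le_rfl hF hF' h0
    (Set.right_mem_Icc.2 hab)

/-- The positivity of the kernel `sin (min x y) cos (max x y)` on `[0, δ]` for `δ < π / 2`, in terms
of the curve `(c, s)` with velocity `φ (cos, sin)` and of twice the area `D` it sweeps. -/
theorem sweptArea_le_mul {c s D φ : ℝ → ℝ} {δ : ℝ} (hδ : 0 ≤ δ) (hδ' : δ < Real.pi / 2)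
    (hc : Continuous c) (hs : Continuous s) (hD : Continuous D)
    (hc0 : c 0 = 0) (hs0 : s 0 = 0) (hD0 : D 0 = 0)
    (hc' : ∀ y, HasDerivWithinAt c (Real.cos y * φ y) (Set.Ici y) y)
    (hs' : ∀ y, HasDerivWithinAt s (Real.sin y * φ y) (Set.Ici y) y)
    (hD' : ∀ y, HasDerivWithinAt D ((c y * Real.sin y - s y * Real.cos y) * φ y) (Set.Ici y) y) :
    D δ ≤ c δ * s δ := by
  have hcos : ∀ y ∈ Set.Icc 0 δ, Real.cos y ≠ 0 := fun y hy =>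
    (Real.cos_pos_of_mem_Ioo ⟨by linarith [hy.1, Real.pi_pos], by linarith [hy.2]⟩).ne'
  -- Since `(c s - D)' = 2 s c'`, the number `c δ * s δ - D δ` is the form with kernel `sin (min)
  -- cos (max) = cos x cos y tan (min x y)`. Writing `tan` as the integral of `1 / cos²` turns the
  -- form into `∫ (c δ - c y)² / cos² y dy`. The function `F` is the corresponding antiderivative:
  -- it is 0 at 0 and `c δ * s δ - D δ` at `δ`.
  have key := le_of_hasDerivWithinAt_right_nonneg
    (F := fun y => c y * s y - D y + 2 * s y * (c δ - c y) + Real.tan y * (c δ - c y) ^ 2)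
    (F' := fun y => 1 / Real.cos y ^ 2 * (c δ - c y) ^ 2) hδ ?_ ?_ ?_
  · simp only [hc0, hs0, hD0, Real.tan_zero, sub_self] at key
    linarith
  · have : ContinuousOn Real.tan (Set.Icc 0 δ) :=
      Real.continuousOn_tan.mono fun y hy => hcos y hy
    fun_prop
  · intro y hy
    have hcy := hcos y ⟨hy.1, hy.2.le⟩
    have hh := (hasDerivWithinAt_const y (Set.Ici y) (c δ)).sub (hc' y)
    have htan := (Real.hasDerivAt_tan hcy).hasDerivWithinAt (s := Set.Ici y)
    have := ((((hc' y).mul (hs' y)).sub (hD' y)).add (((hs' y).const_mul 2).mul hh)).add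
      (htan.mul (hh.pow 2))
    refine this.congr_deriv ?_
    simp only [Pi.sub_apply, Pi.pow_apply, Real.tan_eq_sin_div_cos]
    field_simp
    ring
  · intro y _
    positivity

/-! ### Regularity and time scaling of the fundamental solution. -/

namespace IsFundamentalSolution

variable {c δ : ℝ} {Φ : ℝ → ℝ}

theorem cutContinuous (h : IsFundamentalSolution c δ Φ) : CutContinuous Φ :=
  CutContinuous.of_continuousOn h.continuousOn h.neg

theorem apply_zero (h : IsFundamentalSolution c δ Φ) : Φ 0 = 1 := by
  simpa using h.equation 0 le_rfl

theorem hasDerivWithinAt (h : IsFundamentalSolution c δ Φ) {t : ℝ} (ht : 0 ≤ t) :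
    HasDerivWithinAt Φ (-c * Φ (t - δ)) (Set.Ici t) t := by
  have h1 := ((h.cutContinuous.comp_sub δ).hasDerivWithinAt_integral t).const_mul c
  have h2 := (hasDerivWithinAt_const t (Set.Ici t) (1 : ℝ)).sub h1
  refine (h2.congr (fun x hx => ?_) ?_).congr_deriv (by ring)
  · exact h.equation x (ht.trans hx)
  · exact h.equation t ht

theorem continuousAt (h : IsFundamentalSolution c δ Φ) {t : ℝ} (ht : t ≠ 0) :
    ContinuousAt Φ t := by
  rcases lt_or_gt_of_ne ht with h0 | h0
  · refine continuousAt_const.congr (f := fun _ => (0 : ℝ)) ?_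
    filter_upwards [Iio_mem_nhds h0] with x hx
    exact (h.neg x hx).symm
  · exact h.continuousOn.continuousAt (Ici_mem_nhds h0)

/-- At `t = δ` the delayed argument meets the jump of `Φ` at 0, so a two-sided derivative is only
claimed elsewhere. -/
theorem hasDerivAt (h : IsFundamentalSolution c δ Φ) {t : ℝ} (ht : 0 < t) (htδ : t ≠ δ) :
    HasDerivAt Φ (-c * Φ (t - δ)) t := by
  have h1 := (intervalIntegral.integral_hasDerivAt_right
    ((h.cutContinuous.comp_sub δ).intervalIntegrable 0 t)
    ((h.cutContinuous.comp_sub δ).measurable.stronglyMeasurable.stronglyMeasurableAtFilter)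
    (ContinuousAt.comp (f := fun s => s - δ) (h.continuousAt (sub_ne_zero.2 htδ))
      (by fun_prop))).const_mul c
  have h2 := (hasDerivAt_const t (1 : ℝ)).sub h1
  refine (h2.congr_of_eventuallyEq ?_).congr_deriv (by ring)
  filter_upwards [Ioi_mem_nhds ht] with x hx
  exact h.equation x (le_of_lt hx)

/-- Time scaling turns the rate `c` into the rate `1`. -/
theorem comp_div (h : IsFundamentalSolution c δ Φ) (hc : 0 < c) :
    IsFundamentalSolution 1 (c * δ) fun t => Φ (t / c) where
  neg t ht := h.neg _ (div_neg_of_neg_of_pos ht hc)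
  continuousOn := h.continuousOn.comp (by fun_prop) fun t ht => div_nonneg ht hc.le
  equation t ht := by
    rw [h.equation _ (by positivity)]
    have : ∀ s, Φ ((s - c * δ) / c) = (fun x => Φ (x - δ)) (s / c) := by
      intro s
      simp only
      congr 1
      field_simp
    simp_rw [this]
    rw [intervalIntegral.integral_comp_div (fun x => Φ (x - δ)) hc.ne']
    simp

end IsFundamentalSolution

namespace DelayEnergy

variable {δ : ℝ} {z : ℝ → ℝ}

/-- `∫ cos(q) z(q) dq` over `[0, t]`. -/
noncomputable def cosPrim (z : ℝ → ℝ) (t : ℝ) : ℝ := ∫ q in (0 : ℝ)..t, Real.cos q * z q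

/-- `∫ sin(q) z(q) dq` over `[0, t]`. -/
noncomputable def sinPrim (z : ℝ → ℝ) (t : ℝ) : ℝ := ∫ q in (0 : ℝ)..t, Real.sin q * z q

/-- Twice the signed area swept by the curve `(cosPrim z, sinPrim z)` up to time `t`. -/
noncomputable def areaPrim (z : ℝ → ℝ) (t : ℝ) : ℝ :=
  ∫ q in (0 : ℝ)..t, (cosPrim z q * Real.sin q - sinPrim z q * Real.cos q) * z q

/-- `∫ cos (q - a) z(q) dq` over `[a, b]`. -/
noncomputable def cosWindow (z : ℝ → ℝ) (a b : ℝ) : ℝ :=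
  Real.cos a * (cosPrim z b - cosPrim z a) + Real.sin a * (sinPrim z b - sinPrim z a)

/-- `∫ sin (q - a) z(q) dq` over `[a, b]`. -/
noncomputable def sinWindow (z : ℝ → ℝ) (a b : ℝ) : ℝ :=
  Real.cos a * (sinPrim z b - sinPrim z a) - Real.sin a * (cosPrim z b - cosPrim z a)

/-- `∬ sin (q - q') z(q) z(q') dq' dq` over `a ≤ q' ≤ q ≤ b`. -/
noncomputable def areaWindow (z : ℝ → ℝ) (a b : ℝ) : ℝ :=
  areaPrim z b - areaPrim z a - cosPrim z a * (sinPrim z b - sinPrim z a)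
    + sinPrim z a * (cosPrim z b - cosPrim z a)

theorem continuous_cosPrim (hz : CutContinuous z) : Continuous (cosPrim z) :=
  (hz.continuous_mul Real.continuous_cos).continuous_integral

theorem continuous_sinPrim (hz : CutContinuous z) : Continuous (sinPrim z) :=
  (hz.continuous_mul Real.continuous_sin).continuous_integral

theorem cutContinuous_area (hz : CutContinuous z) : CutContinuous
    fun q => (cosPrim z q * Real.sin q - sinPrim z q * Real.cos q) * z q := by
  have h1 := continuous_cosPrim hz
  have h2 := continuous_sinPrim hz
  exact hz.continuous_mul (by fun_prop)

theorem continuous_areaPrim (hz : CutContinuous z) : Continuous (areaPrim z) :=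
  (cutContinuous_area hz).continuous_integral

theorem hasDerivWithinAt_cosPrim (hz : CutContinuous z) (t : ℝ) :
    HasDerivWithinAt (cosPrim z) (Real.cos t * z t) (Set.Ici t) t :=
  (hz.continuous_mul Real.continuous_cos).hasDerivWithinAt_integral t

theorem hasDerivWithinAt_sinPrim (hz : CutContinuous z) (t : ℝ) :
    HasDerivWithinAt (sinPrim z) (Real.sin t * z t) (Set.Ici t) t :=
  (hz.continuous_mul Real.continuous_sin).hasDerivWithinAt_integral t

theorem hasDerivWithinAt_areaPrim (hz : CutContinuous z) (t : ℝ) :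
    HasDerivWithinAt (areaPrim z)
      ((cosPrim z t * Real.sin t - sinPrim z t * Real.cos t) * z t) (Set.Ici t) t :=
  (cutContinuous_area hz).hasDerivWithinAt_integral t

theorem _root_.HasDerivWithinAt.comp_add_const_Ici {f : ℝ → ℝ} {f' t d : ℝ}
    (h : HasDerivWithinAt f f' (Set.Ici (t + d)) (t + d)) :
    HasDerivWithinAt (fun x => f (x + d)) f' (Set.Ici t) t := by
  have := h.scomp t (((hasDerivAt_id t).add_const d).hasDerivWithinAt (s := Set.Ici t))
    (fun x hx => by simpa using hx)
  simpa [Function.comp_def] using this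

/-- Translating time by `a` and rotating by the angle `a` turns the window into one that starts at
0, where `sweptArea_le_mul` applies. -/
theorem areaWindow_le (hz : CutContinuous z) (hδ : 0 ≤ δ) (hδ' : δ < Real.pi / 2) (a : ℝ) :
    areaWindow z a (a + δ) ≤ cosWindow z a (a + δ) * sinWindow z a (a + δ) := by
  have hc := continuous_cosPrim hz
  have hs := continuous_sinPrim hz
  have hr := continuous_areaPrim hz
  have hc' : ∀ y, HasDerivWithinAt (fun y => cosPrim z (y + a)) _ (Set.Ici y) y := fun y =>
    (hasDerivWithinAt_cosPrim hz (y + a)).comp_add_const_Ici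
  have hs' : ∀ y, HasDerivWithinAt (fun y => sinPrim z (y + a)) _ (Set.Ici y) y := fun y =>
    (hasDerivWithinAt_sinPrim hz (y + a)).comp_add_const_Ici
  have hr' : ∀ y, HasDerivWithinAt (fun y => areaPrim z (y + a)) _ (Set.Ici y) y := fun y =>
    (hasDerivWithinAt_areaPrim hz (y + a)).comp_add_const_Ici
  rw [add_comm a δ]
  refine sweptArea_le_mul (c := fun y => cosWindow z a (y + a)) (s := fun y => sinWindow z a (y + a))
    (D := fun y => areaWindow z a (y + a)) (φ := fun y => z (y + a)) hδ hδ' ?_ ?_ ?_ ?_ ?_ ?_ ?_ ?_ ?_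
  · unfold cosWindow; fun_prop
  · unfold sinWindow; fun_prop
  · unfold areaWindow; fun_prop
  · simp [cosWindow]
  · simp [sinWindow]
  · simp [areaWindow]
  · intro y
    refine ((((hc' y).sub_const _).const_mul _).add
      (((hs' y).sub_const _).const_mul _)).congr_deriv ?_
    rw [Real.cos_add, Real.sin_add]
    linear_combination (Real.cos y * z (y + a)) * Real.sin_sq_add_cos_sq a
  · intro y
    refine ((((hs' y).sub_const _).const_mul _).sub
      (((hc' y).sub_const _).const_mul _)).congr_deriv ?_
    rw [Real.cos_add, Real.sin_add]
    linear_combination (Real.sin y * z (y + a)) * Real.sin_sq_add_cos_sq a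
  · intro y
    refine ((((hr' y).sub_const _).sub (((hs' y).sub_const _).const_mul _)).add
      (((hc' y).sub_const _).const_mul _)).congr_deriv ?_
    simp only [cosWindow, sinWindow]
    rw [Real.cos_add, Real.sin_add]
    ring

/-- The quadratic functional whose value along the fundamental solution is `∫ z²` over `[t, ∞)`. -/
noncomputable def functional (A δ : ℝ) (z : ℝ → ℝ) (t : ℝ) : ℝ :=
  A * z t ^ 2 - 2 * z t * (A * cosWindow z (t - δ) t - 1 / 2 * sinWindow z (t - δ) t)
    + A * (cosWindow z (t - δ) t ^ 2 + sinWindow z (t - δ) t ^ 2) - areaWindow z (t - δ) t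

/-- Replacing the area by its bound `c s` leaves `A (z - c)² + (z - c) s + A s²`, which for `A ≥
1/2` dominates the square `(z - c + s)² / 2`. -/
theorem functional_nonneg (hz : CutContinuous z) (hδ : 0 ≤ δ) (hδ' : δ < Real.pi / 2) {A : ℝ}
    (hA : 1 / 2 ≤ A) (t : ℝ) : 0 ≤ functional A δ z t := by
  have h := areaWindow_le hz hδ hδ' (t - δ)
  rw [sub_add_cancel] at h
  unfold functional
  set c := cosWindow z (t - δ) t
  set s := sinWindow z (t - δ) t
  nlinarith [sq_nonneg (z t - c + s), mul_nonneg (sub_nonneg.2 hA) (sq_nonneg (z t - c)),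
    mul_nonneg (sub_nonneg.2 hA) (sq_nonneg s)]

/-- The moving windows obey a forced rotation: `c' = s + cos δ z(t) - z(t - δ)` and `s' = -c + sin δ
z(t)`. In the derivative of the functional all terms with `z(t - δ)` cancel, and the two conditions
on `A` remove the other cross terms. -/
theorem hasDerivWithinAt_functional (h : IsFundamentalSolution 1 δ z) {A : ℝ}
    (hA1 : 2 * A * Real.cos δ = 1 + Real.sin δ) (hA2 : 2 * A * (1 - Real.sin δ) = Real.cos δ)
    {t : ℝ} (ht : 0 ≤ t) :
    HasDerivWithinAt (functional A δ z) (-z t ^ 2) (Set.Ici t) t := by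
  have hz := h.cutContinuous
  have hcb := hasDerivWithinAt_cosPrim hz t
  have hsb := hasDerivWithinAt_sinPrim hz t
  have hrb := hasDerivWithinAt_areaPrim hz t
  have hca : HasDerivWithinAt (fun t => cosPrim z (t - δ)) _ (Set.Ici t) t :=
    (hasDerivWithinAt_cosPrim hz (t + -δ)).comp_add_const_Ici
  have hsa : HasDerivWithinAt (fun t => sinPrim z (t - δ)) _ (Set.Ici t) t :=
    (hasDerivWithinAt_sinPrim hz (t + -δ)).comp_add_const_Ici
  have hra : HasDerivWithinAt (fun t => areaPrim z (t - δ)) _ (Set.Ici t) t :=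
    (hasDerivWithinAt_areaPrim hz (t + -δ)).comp_add_const_Ici
  simp only [← sub_eq_add_neg] at hca hsa hra
  have hcos : HasDerivWithinAt (fun t => Real.cos (t - δ)) (-Real.sin (t - δ)) (Set.Ici t) t := by
    simpa using (((hasDerivAt_id t).sub_const δ).cos).hasDerivWithinAt
  have hsin : HasDerivWithinAt (fun t => Real.sin (t - δ)) (Real.cos (t - δ)) (Set.Ici t) t := by
    simpa using (((hasDerivAt_id t).sub_const δ).sin).hasDerivWithinAt
  have hcost : Real.cos t = Real.cos (t - δ) * Real.cos δ - Real.sin (t - δ) * Real.sin δ := by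
    rw [← Real.cos_add, sub_add_cancel]
  have hsint : Real.sin t = Real.sin (t - δ) * Real.cos δ + Real.cos (t - δ) * Real.sin δ := by
    rw [← Real.sin_add, sub_add_cancel]
  have h1 := Real.sin_sq_add_cos_sq (t - δ)
  have hc : HasDerivWithinAt (fun t => cosWindow z (t - δ) t)
      (Real.cos δ * z t - z (t - δ) + sinWindow z (t - δ) t) (Set.Ici t) t := by
    refine ((hcos.mul (hcb.sub hca)).add (hsin.mul (hsb.sub hsa))).congr_deriv ?_
    simp only [sinWindow, Pi.sub_apply, hcost, hsint]
    linear_combination (Real.cos δ * z t - z (t - δ)) * h1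
  have hs : HasDerivWithinAt (fun t => sinWindow z (t - δ) t)
      (Real.sin δ * z t - cosWindow z (t - δ) t) (Set.Ici t) t := by
    refine ((hcos.mul (hsb.sub hsa)).sub (hsin.mul (hcb.sub hca))).congr_deriv ?_
    simp only [cosWindow, Pi.sub_apply, hcost, hsint]
    linear_combination (Real.sin δ * z t) * h1
  have hD : HasDerivWithinAt (fun t => areaWindow z (t - δ) t)
      (z t * (Real.sin δ * cosWindow z (t - δ) t - Real.cos δ * sinWindow z (t - δ) t)
        - z (t - δ) * sinWindow z (t - δ) t) (Set.Ici t) t := by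
    refine (((hrb.sub hra).sub (hca.mul (hsb.sub hsa))).add (hsa.mul (hcb.sub hca))).congr_deriv ?_
    simp only [cosWindow, sinWindow, Pi.sub_apply, hcost, hsint]
    ring
  have hzt := h.hasDerivWithinAt ht
  have := (((((hzt.pow 2).const_mul A).sub ((hzt.const_mul 2).mul
    ((hc.const_mul A).sub (hs.const_mul (1 / 2))))).add
    (((hc.pow 2).add (hs.pow 2)).const_mul A)).sub hD)
  refine this.congr_deriv ?_
  simp only [Pi.sub_apply]
  set c := cosWindow z (t - δ) t
  set s := sinWindow z (t - δ) t
  -- `hA1` cancels the `z c` terms and fixes the coefficient of `z²`; `hA2` cancels the `z s` terms.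
  linear_combination (z t * c - z t ^ 2) * hA1 - (z t * s) * hA2

end DelayEnergy

theorem CutContinuous.integral_eq_sub {f : ℝ → ℝ} (hf : CutContinuous f) (a b : ℝ) :
    ∫ q in a..b, f q = (∫ q in (0 : ℝ)..b, f q) - ∫ q in (0 : ℝ)..a, f q :=
  (intervalIntegral.integral_interval_sub_left (hf.intervalIntegrable _ _)
    (hf.intervalIntegrable _ _)).symm

/-! ### Energy balance, and decay of the functional. -/

namespace DelayEnergy

variable {δ : ℝ} {z : ℝ → ℝ}

theorem continuousOn_functional (h : IsFundamentalSolution 1 δ z) (A : ℝ) :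
    ContinuousOn (functional A δ z) (Set.Ici 0) := by
  have hz := h.cutContinuous
  have hc := continuous_cosPrim hz
  have hs := continuous_sinPrim hz
  have hr := continuous_areaPrim hz
  have hzc := h.continuousOn
  unfold functional cosWindow sinWindow areaWindow
  fun_prop

theorem functional_zero (h : IsFundamentalSolution 1 δ z) (hδ : 0 ≤ δ) (A : ℝ) :
    functional A δ z 0 = A := by
  -- At time 0 the window `[-δ, 0]` only sees the zero history, apart from the null point 0, so just
  -- the term `A * z 0 ^ 2` survives.
  have hz0 : ∀ f : ℝ → ℝ, ∫ q in (0 : ℝ)..(-δ), f q * z q = 0 := by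
    intro f
    refine intervalIntegral.integral_zero_ae ?_
    filter_upwards [(measure_eq_zero_iff_ae_notMem (s := {(0 : ℝ)})).1 Real.volume_singleton]
      with s hs hsu
    rw [h.neg s, mul_zero]
    refine lt_of_le_of_ne ?_ hs
    rcases Set.mem_uIoc.1 hsu with h | h <;> linarith [h.1, h.2]
  simp [functional, cosWindow, sinWindow, areaWindow, cosPrim, sinPrim, areaPrim, hz0,
    h.apply_zero]

theorem functional_add_integral (h : IsFundamentalSolution 1 δ z) (hδ : 0 ≤ δ) {A : ℝ}
    (hA1 : 2 * A * Real.cos δ = 1 + Real.sin δ) (hA2 : 2 * A * (1 - Real.sin δ) = Real.cos δ)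
    {t : ℝ} (ht : 0 ≤ t) :
    functional A δ z t + ∫ q in (0 : ℝ)..t, z q ^ 2 = A := by
  have hsq := h.cutContinuous.sq
  have := constant_of_has_deriv_right_zero
    (f := fun t => functional A δ z t + ∫ q in (0 : ℝ)..t, z q ^ 2) (a := 0) (b := t)
    (((continuousOn_functional h A).mono Set.Icc_subset_Ici_self).add
      hsq.continuous_integral.continuousOn)
    (fun x hx => ((hasDerivWithinAt_functional h hA1 hA2 hx.1).add
      (hsq.hasDerivWithinAt_integral x)).congr_deriv (by ring)) t (Set.right_mem_Icc.2 ht)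
  rw [this, functional_zero h hδ]
  simp

theorem abs_integral_sub_le (hz : CutContinuous z) {f : ℝ → ℝ} (hf : Continuous f)
    {a b M ε : ℝ} (hb : b ∈ Set.Icc a (a + δ)) (hM : ∀ q ∈ Set.Ioc a b, |f q| ≤ M)
    (hM0 : 0 ≤ M) (hε0 : 0 ≤ ε) (hε : ∀ q, a < q → |z q| ≤ ε) :
    |(∫ q in (0 : ℝ)..b, f q * z q) - ∫ q in (0 : ℝ)..a, f q * z q| ≤ M * ε * δ := by
  rw [← (hz.continuous_mul hf).integral_eq_sub a b]
  have hle := intervalIntegral.norm_integral_le_of_norm_le_const (a := a) (b := b) (C := M * ε)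
    (f := fun q => f q * z q) fun q hq => ?_
  · refine hle.trans ?_
    rw [abs_of_nonneg (by linarith [hb.1])]
    gcongr
    linarith [hb.2]
  · rw [Set.uIoc_of_le hb.1] at hq
    rw [Real.norm_eq_abs, abs_mul]
    exact mul_le_mul (hM q hq) (hε q hq.1) (abs_nonneg _) hM0

theorem abs_cosPrim_sub_le (hz : CutContinuous z) {a b ε : ℝ} (hb : b ∈ Set.Icc a (a + δ))
    (hε0 : 0 ≤ ε) (hε : ∀ q, a < q → |z q| ≤ ε) : |cosPrim z b - cosPrim z a| ≤ ε * δ := by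
  simpa [cosPrim] using abs_integral_sub_le hz Real.continuous_cos hb
    (fun q _ => Real.abs_cos_le_one q) zero_le_one hε0 hε

theorem abs_sinPrim_sub_le (hz : CutContinuous z) {a b ε : ℝ} (hb : b ∈ Set.Icc a (a + δ))
    (hε0 : 0 ≤ ε) (hε : ∀ q, a < q → |z q| ≤ ε) : |sinPrim z b - sinPrim z a| ≤ ε * δ := by
  simpa [sinPrim] using abs_integral_sub_le hz Real.continuous_sin hb
    (fun q _ => Real.abs_sin_le_one q) zero_le_one hε0 hε

theorem abs_rotate_le {x y θ M : ℝ} (hx : |x| ≤ M) (hy : |y| ≤ M) :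
    |x * Real.sin θ - y * Real.cos θ| ≤ 2 * M := by
  have hM : 0 ≤ M := (abs_nonneg x).trans hx
  calc |x * Real.sin θ - y * Real.cos θ|
      ≤ |x * Real.sin θ| + |y * Real.cos θ| := abs_sub _ _
    _ = |x| * |Real.sin θ| + |y| * |Real.cos θ| := by rw [abs_mul, abs_mul]
    _ ≤ M * 1 + M * 1 := by
        gcongr
        exacts [Real.abs_sin_le_one θ, Real.abs_cos_le_one θ]
    _ = 2 * M := by ring

/-- With the primitives recentred at `a`, the area is one integral of `z` against a factor that is
itself of size at most `2 ε δ`. -/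
theorem abs_areaWindow_le (hz : CutContinuous z) (hδ : 0 ≤ δ) {a ε : ℝ}
    (hε0 : 0 ≤ ε) (hε : ∀ q, a < q → |z q| ≤ ε) :
    |areaWindow z a (a + δ)| ≤ 2 * (ε * δ) * ε * δ := by
  have hc := continuous_cosPrim hz
  have hs := continuous_sinPrim hz
  have h := abs_integral_sub_le hz (δ := δ) (a := a) (b := a + δ) (M := 2 * (ε * δ))
    (f := fun q => (cosPrim z q - cosPrim z a) * Real.sin q
      - (sinPrim z q - sinPrim z a) * Real.cos q) (by fun_prop) ⟨by linarith, le_rfl⟩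
    (fun q hq => abs_rotate_le (abs_cosPrim_sub_le hz (Set.Ioc_subset_Icc_self hq) hε0 hε)
      (abs_sinPrim_sub_le hz (Set.Ioc_subset_Icc_self hq) hε0 hε)) (by positivity) hε0 hε
  convert h using 2
  have hsplit : ∀ b, ∫ q in (0 : ℝ)..b, ((cosPrim z q - cosPrim z a) * Real.sin q
      - (sinPrim z q - sinPrim z a) * Real.cos q) * z q
      = areaPrim z b - cosPrim z a * sinPrim z b + sinPrim z a * cosPrim z b := by
    intro b
    unfold areaPrim
    conv_rhs => enter [1, 2]; unfold sinPrim
    conv_rhs => enter [2]; unfold cosPrim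
    rw [← intervalIntegral.integral_const_mul, ← intervalIntegral.integral_const_mul,
      ← intervalIntegral.integral_sub ((cutContinuous_area hz).intervalIntegrable _ _)
        (((hz.continuous_mul Real.continuous_sin).intervalIntegrable _ _).const_mul _),
      ← intervalIntegral.integral_add
        (((cutContinuous_area hz).intervalIntegrable _ _).sub
        (((hz.continuous_mul Real.continuous_sin).intervalIntegrable _ _).const_mul _))
        (((hz.continuous_mul Real.continuous_cos).intervalIntegrable _ _).const_mul _)]
    refine intervalIntegral.integral_congr fun q _ => ?_
    ring
  rw [hsplit, hsplit, areaWindow]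
  ring

theorem tendsto_zero_of_eventually_le {f : ℝ → ℝ} {K : ℝ}
    (h : ∀ ε, 0 < ε → ε ≤ 1 → ∀ᶠ t in atTop, |f t| ≤ K * ε) : Tendsto f atTop (𝓝 0) := by
  rw [Metric.tendsto_nhds]
  intro ε hε
  have hK : 0 < |K| + 1 := by positivity
  filter_upwards [h (min 1 (ε / (2 * (|K| + 1)))) (by positivity) (min_le_left _ _)] with t ht
  rw [Real.dist_eq, sub_zero]
  calc |f t| ≤ K * min 1 (ε / (2 * (|K| + 1))) := ht
    _ ≤ (|K| + 1) * (ε / (2 * (|K| + 1))) := by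
        gcongr
        · linarith [le_abs_self K]
        · exact min_le_right _ _
    _ = ε / 2 := by field_simp
    _ < ε := by linarith

theorem tendsto_functional (hz : CutContinuous z) (hδ : 0 ≤ δ) (A : ℝ)
    (hlim : Tendsto z atTop (𝓝 0)) : Tendsto (functional A δ z) atTop (𝓝 0) := by
  have hev : ∀ ε, 0 < ε → ∀ᶠ t in atTop, ∀ q, t - δ < q → |z q| ≤ ε := by
    intro ε hε
    obtain ⟨T, hT⟩ := eventually_atTop.1 ((Metric.tendsto_nhds.1 hlim) ε hε)
    filter_upwards [eventually_ge_atTop (T + δ)] with t ht q hq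
    simpa using (hT q (by linarith)).le
  have hmem : ∀ t, t ∈ Set.Icc (t - δ) (t - δ + δ) := fun t => ⟨by linarith, by linarith⟩
  have hc : Tendsto (fun t => cosWindow z (t - δ) t) atTop (𝓝 0) := by
    refine tendsto_zero_of_eventually_le (K := 2 * δ) fun ε hε _ => ?_
    filter_upwards [hev ε hε] with t ht
    have := abs_rotate_le (θ := t - δ) (abs_sinPrim_sub_le hz (hmem t) hε.le ht)
      ((abs_neg _).trans_le (abs_cosPrim_sub_le hz (hmem t) hε.le ht))
    calc _ = _ := by rw [cosWindow]; congr 1; ring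
      _ ≤ _ := this
      _ = _ := by ring
  have hs : Tendsto (fun t => sinWindow z (t - δ) t) atTop (𝓝 0) := by
    refine tendsto_zero_of_eventually_le (K := 2 * δ) fun ε hε _ => ?_
    filter_upwards [hev ε hε] with t ht
    have := abs_rotate_le (θ := t - δ)
      ((abs_neg _).trans_le (abs_cosPrim_sub_le hz (hmem t) hε.le ht))
      ((abs_neg _).trans_le (abs_sinPrim_sub_le hz (hmem t) hε.le ht))
    calc _ = _ := by rw [sinWindow]; congr 1; ring
      _ ≤ _ := this
      _ = _ := by ring
  have hD : Tendsto (fun t => areaWindow z (t - δ) t) atTop (𝓝 0) := by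
    refine tendsto_zero_of_eventually_le (K := 2 * δ * δ) fun ε hε hε1 => ?_
    filter_upwards [hev ε hε] with t ht
    have := abs_areaWindow_le hz hδ hε.le ht
    rw [sub_add_cancel] at this
    refine this.trans ?_
    -- The area is quadratic in `ε`; `ε ≤ 1` makes the bound linear.
    nlinarith [mul_nonneg (mul_nonneg hδ hδ) (mul_nonneg hε.le (sub_nonneg.2 hε1))]
  have := ((((hlim.pow 2).const_mul A).sub ((hlim.const_mul 2).mul
    ((hc.const_mul A).sub (hs.const_mul (1 / 2))))).add
    (((hc.pow 2).add (hs.pow 2)).const_mul A)).sub hD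
  unfold functional
  simpa using this

end DelayEnergy

/-! ### Decay and square integral of the fundamental solution. -/

namespace IsFundamentalSolution

variable {c δ : ℝ} {z Φ : ℝ → ℝ}

/-- The derivative `-2 z(t) z(t - δ)` of `z²` is bounded by `z(t)² + z(t - δ)²`. So `z²` and its
derivative are both integrable, and `z²` tends to 0. Working beyond `δ` avoids the kink there. -/
theorem tendsto_zero_of_integral_sq_le (h : IsFundamentalSolution 1 δ z) (hδ : 0 ≤ δ) {A : ℝ}
    (hA : ∀ t, 0 ≤ t → ∫ q in (0 : ℝ)..t, z q ^ 2 ≤ A) : Tendsto z atTop (𝓝 0) := by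
  have hz := h.cutContinuous
  have hint : ∀ d, 0 ≤ d → IntegrableOn (fun t => z (t - d) ^ 2) (Set.Ioi δ) := by
    intro d hd
    have h0 : IntegrableOn (fun t => z t ^ 2) (Set.Ioi (δ - d)) := by
      refine integrableOn_Ioi_of_intervalIntegral_norm_bounded (A - ∫ q in (0 : ℝ)..(δ - d), z q ^ 2)
        (δ - d) (b := id) (l := atTop)
        (fun i => (hz.sq.intervalIntegrable (δ - d) i).1) tendsto_id ?_
      filter_upwards [eventually_ge_atTop 0] with t ht
      simp only [norm_pow, Real.norm_eq_abs, sq_abs, id]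
      rw [hz.sq.integral_eq_sub]
      linarith [hA t ht]
    have := (measurePreserving_sub_right volume d).integrableOn_comp_preimage
      (Homeomorph.subRight d).measurableEmbedding (f := fun t => z t ^ 2) (s := Set.Ioi (δ - d))
    rw [Set.preimage_sub_const_Ioi, sub_add_cancel] at this
    exact this.2 h0
  have hsq : Tendsto (fun t => z t ^ 2) atTop (𝓝 0) := by
    refine tendsto_zero_of_hasDerivAt_of_integrableOn_Ioi (a := δ)
      (f' := fun t => 2 * z t * (-1 * z (t - δ))) (fun t ht => ?_) ?_ (by simpa using hint 0 le_rfl)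
    · refine ((h.hasDerivAt (hδ.trans_lt ht) (ne_of_gt ht)).pow 2).congr_deriv ?_
      simp
    · refine ((hint 0 le_rfl).add (hint δ hδ)).mono' ?_ (ae_of_all _ fun t => ?_)
      · exact (((hz.measurable.const_mul 2).mul
          ((hz.comp_sub δ).measurable.const_mul (-1)))).aestronglyMeasurable
      · simp only [Pi.add_apply, sub_zero, Real.norm_eq_abs]
        rw [abs_le]
        constructor <;> nlinarith [sq_nonneg (z t - z (t - δ)), sq_nonneg (z t + z (t - δ))]
  have := hsq.sqrt
  simp only [Real.sqrt_sq_eq_abs, Real.sqrt_zero] at this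
  exact (tendsto_zero_iff_abs_tendsto_zero _).2 this

/-- The functional is used twice: its sign bounds `∫ z²` and thereby gives decay; decay then makes
it vanish at infinity, which turns the bound into an equality. -/
theorem tendsto_of_unit_rate (h : IsFundamentalSolution 1 δ z) (hδ : 0 ≤ δ)
    (hδ' : δ < Real.pi / 2) :
    Tendsto z atTop (𝓝 0) ∧ Tendsto (fun t => ∫ q in (0 : ℝ)..t, z q ^ 2) atTop
      (𝓝 (Real.cos δ / (2 * (1 - Real.sin δ)))) := by
  have hcos : 0 < Real.cos δ := Real.cos_pos_of_mem_Ioo ⟨by linarith [Real.pi_pos], hδ'⟩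
  have hsin : 0 ≤ Real.sin δ := Real.sin_nonneg_of_nonneg_of_le_pi hδ (by linarith)
  have hsc := Real.sin_sq_add_cos_sq δ
  have hsin1 : Real.sin δ < 1 := by nlinarith
  set A := Real.cos δ / (2 * (1 - Real.sin δ)) with hAdef
  have hne : (1 - Real.sin δ) ≠ 0 := by linarith
  have hA2 : 2 * A * (1 - Real.sin δ) = Real.cos δ := by
    rw [hAdef]; field_simp
  have hA1 : 2 * A * Real.cos δ = 1 + Real.sin δ := by
    rw [hAdef]; field_simp; linarith
  have hA : 1 / 2 ≤ A := by nlinarith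
  have hz := h.cutContinuous
  have hle : ∀ t, 0 ≤ t → ∫ q in (0 : ℝ)..t, z q ^ 2 ≤ A := by
    intro t ht
    have h1 := DelayEnergy.functional_add_integral h hδ hA1 hA2 ht
    have h2 := DelayEnergy.functional_nonneg hz hδ hδ' hA t
    linarith
  have hlim := h.tendsto_zero_of_integral_sq_le hδ hle
  refine ⟨hlim, ?_⟩
  have := (DelayEnergy.tendsto_functional hz hδ A hlim).const_sub A
  rw [sub_zero] at this
  refine this.congr' ?_
  filter_upwards [eventually_ge_atTop 0] with t ht
  linarith [DelayEnergy.functional_add_integral h hδ hA1 hA2 ht]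

theorem tendsto_zero (h : IsFundamentalSolution c δ Φ) (hc : 0 < c) (hδ : 0 ≤ δ)
    (hδ' : c * δ < Real.pi / 2) : Tendsto Φ atTop (𝓝 0) := by
  have := ((h.comp_div hc).tendsto_of_unit_rate (by positivity) hδ').1.comp
    (tendsto_id.const_mul_atTop hc)
  refine this.congr fun t => ?_
  simp [hc.ne']

theorem tendsto_integral_sq (h : IsFundamentalSolution c δ Φ) (hc : 0 < c) (hδ : 0 ≤ δ)
    (hδ' : c * δ < Real.pi / 2) :
    Tendsto (fun t => ∫ q in (0 : ℝ)..t, Φ q ^ 2) atTop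
      (𝓝 (Real.cos (c * δ) / (2 * c * (1 - Real.sin (c * δ))))) := by
  have := (((h.comp_div hc).tendsto_of_unit_rate (by positivity) hδ').2.comp
    (tendsto_id.const_mul_atTop hc)).const_mul c⁻¹
  have hval : c⁻¹ * (Real.cos (c * δ) / (2 * (1 - Real.sin (c * δ))))
      = Real.cos (c * δ) / (2 * c * (1 - Real.sin (c * δ))) := by
    rw [inv_mul_eq_div, div_div]; ring
  rw [hval] at this
  refine this.congr fun t => ?_
  simp only [Function.comp, id]
  rw [intervalIntegral.integral_comp_div (fun q => Φ q ^ 2) hc.ne']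
  simp [hc.ne']

end IsFundamentalSolution

/-! ### Variation of constants -/

/-- Measurable functions that are bounded on bounded sets. -/
structure LocallyBoundedMeasurable (f : ℝ → ℝ) : Prop where
  measurable : Measurable f
  bounded : ∀ R, ∃ M, ∀ q, |q| ≤ R → |f q| ≤ M

namespace LocallyBoundedMeasurable

variable {f g : ℝ → ℝ}

theorem mul (hf : LocallyBoundedMeasurable f) (hg : LocallyBoundedMeasurable g) :
    LocallyBoundedMeasurable fun t => f t * g t where
  measurable := hf.measurable.mul hg.measurable
  bounded R := by
    obtain ⟨M, hM⟩ := hf.bounded R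
    obtain ⟨N, hN⟩ := hg.bounded R
    refine ⟨M * N, fun q hq => ?_⟩
    rw [abs_mul]
    exact mul_le_mul (hM q hq) (hN q hq) (abs_nonneg _) ((abs_nonneg _).trans (hM q hq))

/-- Convolutions need this reflection, which `CutContinuous` does not survive; hence the weaker
class. -/
theorem comp_sub_left (hf : LocallyBoundedMeasurable f) (a : ℝ) :
    LocallyBoundedMeasurable fun t => f (a - t) where
  measurable := hf.measurable.comp (by fun_prop)
  bounded R := by
    obtain ⟨M, hM⟩ := hf.bounded (|a| + R)
    exact ⟨M, fun q hq => hM _ ((abs_sub _ _).trans (by linarith))⟩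

theorem comp_sub_right (hf : LocallyBoundedMeasurable f) (a : ℝ) :
    LocallyBoundedMeasurable fun t => f (t - a) where
  measurable := hf.measurable.comp (by fun_prop)
  bounded R := by
    obtain ⟨M, hM⟩ := hf.bounded (R + |a|)
    exact ⟨M, fun q hq => hM _ ((abs_sub _ _).trans (by linarith))⟩

theorem intervalIntegrable (hf : LocallyBoundedMeasurable f) (a b : ℝ) :
    IntervalIntegrable f volume a b := by
  obtain ⟨M, hM⟩ := hf.bounded (max |a| |b|)
  refine (intervalIntegrable_const (c := M)).mono_fun hf.measurable.aestronglyMeasurable ?_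
  filter_upwards [ae_restrict_mem measurableSet_uIoc] with q hq
  have h1 := hM q (abs_le_max_abs_abs hq.1.le hq.2 |>.trans ?_)
  · exact h1.trans (le_abs_self M)
  · rcases le_total a b with h | h <;> simp [h, le_total]

end LocallyBoundedMeasurable

theorem Continuous.locallyBoundedMeasurable {f : ℝ → ℝ} (hf : Continuous f) :
    LocallyBoundedMeasurable f where
  measurable := hf.measurable
  bounded R := by
    obtain ⟨M, hM⟩ := (isCompact_Icc (a := -R) (b := R)).exists_bound_of_continuousOn hf.continuousOn
    exact ⟨M, fun q hq => hM q (abs_le.1 hq)⟩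

theorem CutContinuous.locallyBoundedMeasurable {f : ℝ → ℝ} (hf : CutContinuous f) :
    LocallyBoundedMeasurable f where
  measurable := hf.measurable
  bounded R := by
    obtain ⟨a, g, hg, rfl⟩ := hf
    obtain ⟨M, hM⟩ := hg.locallyBoundedMeasurable.bounded R
    refine ⟨M, fun q hq => ?_⟩
    refine le_trans ?_ (hM q hq)
    rw [Set.indicator_apply]
    split_ifs
    · exact le_rfl
    · simp

namespace IsFundamentalSolution

variable {c δ : ℝ} {Φ : ℝ → ℝ}

/-- Substituting `s + δ` moves the interval to `[δ, t + δ]`. The discrepancy with `[0, t]` vanishes: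
on `[0, δ)` because `x` has zero history, beyond `t` because `Φ` has. -/
theorem integral_shift {x : ℝ → ℝ} (h : IsFundamentalSolution c δ Φ) (hδ : 0 ≤ δ)
    (hx : CutContinuous x) (hneg : ∀ s < 0, x s = 0) (t : ℝ) :
    ∫ s in (0 : ℝ)..t, Φ (t - s - δ) * x s = ∫ s in (0 : ℝ)..t, Φ (t - s) * x (s - δ) := by
  have hΦ := h.cutContinuous.locallyBoundedMeasurable
  have hint : ∀ a b, IntervalIntegrable (fun s => Φ (t - s) * x (s - δ)) volume a b :=
    ((hΦ.comp_sub_left t).mul (hx.locallyBoundedMeasurable.comp_sub_right δ)).intervalIntegrable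
  have h1 := intervalIntegral.integral_comp_add_right (a := 0) (b := t)
    (fun s => Φ (t - s) * x (s - δ)) δ
  simp only [add_sub_cancel_right, ← sub_sub, zero_add] at h1
  rw [h1]
  have hne : ∀ p : ℝ, ∀ᵐ s : ℝ, s ≠ p := fun p =>
    (measure_eq_zero_iff_ae_notMem (s := {p})).1 Real.volume_singleton
  have h2 : ∫ s in (0 : ℝ)..δ, Φ (t - s) * x (s - δ) = 0 := by
    refine intervalIntegral.integral_zero_ae ?_
    filter_upwards [hne δ] with s hs hsu
    rw [Set.uIoc_of_le hδ] at hsu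
    rw [hneg _ (sub_neg.2 (lt_of_le_of_ne hsu.2 hs)), mul_zero]
  have h3 : ∫ s in t..(t + δ), Φ (t - s) * x (s - δ) = 0 := by
    refine intervalIntegral.integral_zero_ae (ae_of_all _ fun s hsu => ?_)
    rw [Set.uIoc_of_le (by linarith)] at hsu
    rw [h.neg _ (sub_neg.2 hsu.1), zero_mul]
  have h4 := intervalIntegral.integral_add_adjacent_intervals (hint 0 δ) (hint δ (t + δ))
  have h5 := intervalIntegral.integral_add_adjacent_intervals (hint 0 t) (hint t (t + δ))
  linarith

/-- Variation of constants for the delay equation, for cut-off histories. -/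
theorem representation_of_cut {x g : ℝ → ℝ} (h : IsFundamentalSolution c δ Φ)
    (hδ : 0 ≤ δ) (hx : ContinuousOn x (Set.Ici 0)) (hneg : ∀ s < 0, x s = 0)
    (heq : ∀ t, 0 ≤ t → x t = g t - c * ∫ s in (0 : ℝ)..t, x (s - δ)) {t : ℝ} (ht : 0 ≤ t) :
    x t = g t - c * ∫ s in (0 : ℝ)..t, Φ (t - s - δ) * g s := by
  have hxc := CutContinuous.of_continuousOn hx hneg
  have hΦ := h.cutContinuous.locallyBoundedMeasurable
  set Y : ℝ → ℝ := fun t => ∫ s in (0 : ℝ)..t, x (s - δ) with hY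
  have hYc : Continuous Y := (hxc.comp_sub δ).continuous_integral
  have hi1 := ((((hΦ.comp_sub_right δ).comp_sub_left t).mul
    hYc.locallyBoundedMeasurable).intervalIntegrable 0 t).const_mul c
  have hi2 := ((hΦ.comp_sub_left t).mul
    (hxc.locallyBoundedMeasurable.comp_sub_right δ)).intervalIntegrable 0 t
  have hi3 := ((((hΦ.comp_sub_right δ).comp_sub_left t).mul
    hxc.locallyBoundedMeasurable).intervalIntegrable 0 t)
  have hxat : ∀ s, s ≠ 0 → ContinuousAt x s := by
    intro s hs
    rcases lt_or_gt_of_ne hs with h0 | h0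
    · refine continuousAt_const.congr (f := fun _ => (0 : ℝ)) ?_
      filter_upwards [Iio_mem_nhds h0] with y hy
      exact (hneg y hy).symm
    · exact hx.continuousAt (Ici_mem_nhds h0)
  -- Integrating the derivative of `Φ (t - s) * Y s` and applying `integral_shift` expresses `Y t`
  -- through `x + c * Y`, which is `g`. The exceptional points are the kinks: `Y` at `δ`, and `Φ (t
  -- - ·)` at `t - δ`.
  have key := integral_eq_of_hasDerivAt_off_countable_of_le (fun s => Φ (t - s) * Y s)
    (fun s => c * (Φ (t - s - δ) * Y s) + Φ (t - s) * x (s - δ)) ht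
    (s := {δ, t - δ}) (Set.to_countable _) ?_ ?_ (hi1.add hi2)
  · rw [intervalIntegral.integral_add hi1 hi2, intervalIntegral.integral_const_mul,
      ← h.integral_shift hδ hxc hneg] at key
    have hY0 : Y 0 = 0 := by simp [hY]
    simp only [sub_self, h.apply_zero, sub_zero, one_mul, hY0, mul_zero] at key
    have hg : ∫ s in (0 : ℝ)..t, Φ (t - s - δ) * g s
        = c * (∫ s in (0 : ℝ)..t, Φ (t - s - δ) * Y s)
          + ∫ s in (0 : ℝ)..t, Φ (t - s - δ) * x s := by
      rw [← intervalIntegral.integral_const_mul, ← intervalIntegral.integral_add hi1 hi3]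
      refine intervalIntegral.integral_congr fun s hs => ?_
      rw [Set.uIcc_of_le ht] at hs
      rw [heq s hs.1]
      ring
    rw [hg, key]
    exact heq t ht
  · refine ContinuousOn.mul (h.continuousOn.comp (by fun_prop) ?_) hYc.continuousOn
    exact fun s hs => sub_nonneg.2 hs.2
  · rintro s ⟨hs, hsδ⟩
    simp only [Set.mem_insert_iff, Set.mem_singleton_iff, not_or] at hsδ
    have h1 : HasDerivAt (fun s => Φ (t - s)) (c * Φ (t - s - δ)) s := by
      have := (h.hasDerivAt (t := t - s) (by linarith [hs.2]) (fun h => hsδ.2 (by linarith))).scomp s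
        ((hasDerivAt_id s).const_sub t)
      refine this.congr_deriv ?_
      simp
    have h2 : HasDerivAt Y (x (s - δ)) s :=
      intervalIntegral.integral_hasDerivAt_right ((hxc.comp_sub δ).intervalIntegrable 0 s)
        ((hxc.comp_sub δ).measurable.stronglyMeasurable.stronglyMeasurableAtFilter)
        (ContinuousAt.comp (f := fun s => s - δ) (hxat _ (sub_ne_zero.2 hsδ.1)) (by fun_prop))
    exact (h1.mul h2).congr_deriv (by ring)

/-- Variation of constants for the delay equation. -/
theorem representation {x g : ℝ → ℝ} (h : IsFundamentalSolution c δ Φ)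
    (hδ : 0 ≤ δ) (hx : ContinuousOn x (Set.Ici 0)) (hneg : ∀ s ∈ Set.Ico (-δ) 0, x s = 0)
    (heq : ∀ t, 0 ≤ t → x t = g t - c * ∫ s in (0 : ℝ)..t, x (s - δ)) {t : ℝ} (ht : 0 ≤ t) :
    x t = g t - c * ∫ s in (0 : ℝ)..t, Φ (t - s - δ) * g s := by
  have hmem : ∀ s, 0 ≤ s → (Set.Ici 0).indicator x s = x s := fun s hs =>
    Set.indicator_of_mem hs _
  rw [← hmem t ht]
  -- Values of `x` before `-δ` are unknown, but the equation never reads them, so cutting `x` off at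
  -- 0 preserves it.
  refine h.representation_of_cut hδ (hx.congr fun s hs => hmem s hs)
    (fun s hs => Set.indicator_of_notMem (by simpa using hs) _) (fun u hu => ?_) ht
  rw [hmem u hu, heq u hu]
  congr 2
  refine intervalIntegral.integral_congr fun s hs => ?_
  rw [Set.uIcc_of_le hu] at hs
  simp only [Set.indicator_apply, Set.mem_Ici]
  split_ifs with h0
  · rfl
  · exact hneg _ ⟨by linarith [hs.1], by linarith⟩

theorem one_sub_integral (h : IsFundamentalSolution c δ Φ) {u t : ℝ} (hut : u ≤ t) :
    1 - c * ∫ s in u..t, Φ (t - s - δ) = Φ (t - u) := by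
  rw [h.equation _ (sub_nonneg.2 hut), intervalIntegral.integral_comp_sub_left
    (fun s => Φ (s - δ)) t, sub_self]

end IsFundamentalSolution

/-! ### Second moments of integrals of processes -/

section Fubini

theorem sq_integral_eq_integral_prod {S : Type*} [MeasurableSpace S] {μ : Measure S} [SFinite μ]
    (f : S → ℝ) : (∫ s, f s ∂μ) ^ 2 = ∫ p : S × S, f p.1 * f p.2 ∂(μ.prod μ) := by
  rw [sq, integral_prod_mul]

variable {Ω S : Type*} [MeasurableSpace Ω] [MeasurableSpace S] {P : Measure Ω} {μ : Measure S}
  [IsFiniteMeasure P] [IsFiniteMeasure μ] {Z : Ω → S → ℝ}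

/-- The product is dominated by the sum of the two squares, each integrable on the triple product
because `μ` is finite. -/
theorem integrable_mul_kernel (hZ : AEStronglyMeasurable (Function.uncurry Z) (P.prod μ))
    (hZ2 : Integrable (fun p : Ω × S => Z p.1 p.2 ^ 2) (P.prod μ)) :
    Integrable (fun p : Ω × (S × S) => Z p.1 p.2.1 * Z p.1 p.2.2) (P.prod (μ.prod μ)) := by
  have hassoc := (measurePreserving_prodAssoc P μ μ).symm
  have hswap : MeasurePreserving (Prod.map id Prod.swap) (P.prod (μ.prod μ)) (P.prod (μ.prod μ)) :=
    (MeasurePreserving.id P).prod Measure.measurePreserving_swap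
  have m1 : AEStronglyMeasurable (fun p : Ω × (S × S) => Z p.1 p.2.1) (P.prod (μ.prod μ)) :=
    (hZ.comp_fst (ν := μ)).comp_measurePreserving hassoc
  have m2 : AEStronglyMeasurable (fun p : Ω × (S × S) => Z p.1 p.2.2) (P.prod (μ.prod μ)) :=
    m1.comp_measurePreserving hswap
  have i1 : Integrable (fun p : Ω × (S × S) => Z p.1 p.2.1 ^ 2) (P.prod (μ.prod μ)) :=
    hassoc.integrable_comp_of_integrable (hZ2.comp_fst μ)
  have i2 : Integrable (fun p : Ω × (S × S) => Z p.1 p.2.2 ^ 2) (P.prod (μ.prod μ)) :=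
    hswap.integrable_comp_of_integrable i1
  refine (i1.add i2).mono' (m1.mul m2) (ae_of_all _ fun p => ?_)
  simp only [Pi.add_apply, Real.norm_eq_abs]
  rw [abs_le]
  constructor <;> nlinarith [sq_nonneg (Z p.1 p.2.1 - Z p.1 p.2.2),
    sq_nonneg (Z p.1 p.2.1 + Z p.1 p.2.2)]

theorem integrable_sq_integral (hZ : AEStronglyMeasurable (Function.uncurry Z) (P.prod μ))
    (hZ2 : Integrable (fun p : Ω × S => Z p.1 p.2 ^ 2) (P.prod μ)) :
    Integrable (fun ω => (∫ s, Z ω s ∂μ) ^ 2) P := by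
  simp_rw [sq_integral_eq_integral_prod]
  exact (integrable_mul_kernel hZ hZ2).integral_prod_left

/-- The second moment of `∫ Z(ω, s) dμ(s)`, in terms of the covariance kernel `K` of `Z`. -/
theorem integral_sq_integral (hZ : AEStronglyMeasurable (Function.uncurry Z) (P.prod μ))
    (hZ2 : Integrable (fun p : Ω × S => Z p.1 p.2 ^ 2) (P.prod μ)) {K : S → S → ℝ}
    (hK : ∀ᵐ s ∂μ, ∀ᵐ s' ∂μ, ∫ ω, Z ω s * Z ω s' ∂P = K s s') :
    ∫ ω, (∫ s, Z ω s ∂μ) ^ 2 ∂P = ∫ s, ∫ s', K s s' ∂μ ∂μ := by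
  have hint := integrable_mul_kernel hZ hZ2
  simp_rw [sq_integral_eq_integral_prod]
  rw [integral_integral_swap (f := fun ω (p : S × S) => Z ω p.1 * Z ω p.2) hint,
    integral_prod _ hint.integral_prod_right]
  refine integral_congr_ae ?_
  filter_upwards [hK] with s hs
  exact integral_congr_ae hs

end Fubini

section Paths

variable {Ω : Type*} [MeasurableSpace Ω] {P : Measure Ω}

/-- A process with almost surely continuous paths is jointly measurable up to null sets. -/
theorem aemeasurable_uncurry_of_ae_continuous {X : ℝ≥0 → Ω → ℝ} (hX : ∀ t, AEMeasurable (X t) P)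
    (hc : ∀ᵐ ω ∂P, Continuous fun t => X t ω) (ν : Measure ℝ) [SFinite ν] :
    AEMeasurable (fun p : Ω × ℝ => X p.2.toNNReal p.1) (P.prod ν) := by
  -- Sampling at grid times involves countably many variables, so all can be replaced at once by
  -- measurable versions; path continuity recovers the process as the mesh shrinks.
  let q : ℕ → ℕ → ℝ≥0 := fun n m => m / (n + 1)
  let f : ℕ → Ω × ℝ → ℝ := fun n p =>
    (hX (q n ⌊p.2.toNNReal * (n + 1)⌋₊)).mk _ p.1
  have hq : ∀ᵐ ω ∂P, ∀ n m, X (q n m) ω = (hX (q n m)).mk _ ω :=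
    ae_all_iff.2 fun n => ae_all_iff.2 fun m => (hX (q n m)).ae_eq_mk
  refine aemeasurable_of_tendsto_metrizable_ae atTop (f := f) (fun n => ?_) ?_
  · have h1 : Measurable fun p : ℕ × Ω => (hX (q n p.1)).mk _ p.2 :=
      measurable_from_prod_countable_right fun m => (hX (q n m)).measurable_mk
    have h2 : Measurable fun p : Ω × ℝ => (⌊p.2.toNNReal * (n + 1)⌋₊, p.1) := by
      refine Measurable.prodMk ?_ measurable_fst
      exact Nat.measurable_floor.comp (by fun_prop)
    exact (h1.comp h2).aemeasurable
  · have h3 := Measure.quasiMeasurePreserving_fst (μ := P) (ν := ν) |>.ae (hc.and hq)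
    filter_upwards [h3] with p hp
    have : ∀ n, f n p = X (q n ⌊p.2.toNNReal * (n + 1)⌋₊) p.1 := fun n => (hp.2 _ _).symm
    simp_rw [this]
    refine (hp.1.tendsto _).comp ?_
    have h4 := (tendsto_nat_floor_mul_div_atTop (R := ℝ) (a := p.2.toNNReal) (by positivity)).comp
      ((tendsto_natCast_atTop_atTop (R := ℝ)).comp (tendsto_add_atTop_nat 1))
    rw [← NNReal.tendsto_coe]
    refine h4.congr fun n => ?_
    simp only [q, Function.comp]
    push_cast
    congr 2

end Paths

/-! ### The response of the delay equation to white noise -/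

/-- The measure `δ_t + 1_{(0, t]} ds`, which carries the point value at `t` and the integral
over `[0, t]`. -/
noncomputable def pathMeasure (t : ℝ) : Measure ℝ :=
  Measure.dirac t + volume.restrict (Set.Ioc 0 t)

instance (t : ℝ) : IsFiniteMeasure (pathMeasure t) := by
  unfold pathMeasure; infer_instance

theorem ae_pathMeasure_mem {t : ℝ} (ht : 0 ≤ t) : ∀ᵐ s ∂(pathMeasure t), s ∈ Set.Icc 0 t := by
  rw [pathMeasure, ae_add_measure_iff]
  refine ⟨(ae_dirac_iff measurableSet_Icc).2 ⟨ht, le_rfl⟩, ?_⟩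
  filter_upwards [ae_restrict_mem measurableSet_Ioc] with s hs using Set.Ioc_subset_Icc_self hs

/-- The density of the response at time `t` with respect to `pathMeasure t`. -/
noncomputable def responseWeight (c δ : ℝ) (Φ : ℝ → ℝ) (t s : ℝ) : ℝ :=
  if s = t then 1 else -(c * Φ (t - s - δ))

/-- The response `f(t) - c ∫ Φ(t - s - δ) f(s) ds` at time `t` to the forcing `f`. -/
noncomputable def response (c δ : ℝ) (Φ : ℝ → ℝ) (f : ℝ → ℝ) (t : ℝ) : ℝ :=
  f t - c * ∫ s in (0 : ℝ)..t, Φ (t - s - δ) * f s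

namespace LocallyBoundedMeasurable

variable {f : ℝ → ℝ}

theorem integrable_pathMeasure (hf : LocallyBoundedMeasurable f) {t : ℝ} (ht : 0 ≤ t) :
    Integrable f (pathMeasure t) := by
  obtain ⟨M, hM⟩ := hf.bounded t
  refine (integrable_const M).mono' hf.measurable.aestronglyMeasurable ?_
  filter_upwards [ae_pathMeasure_mem ht] with s hs
  exact hM s (abs_le.2 ⟨by linarith [hs.1], hs.2⟩)

theorem integral_pathMeasure (hf : LocallyBoundedMeasurable f) {t : ℝ} (ht : 0 ≤ t) :
    ∫ s, f s ∂(pathMeasure t) = f t + ∫ s in (0 : ℝ)..t, f s := by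
  have h := hf.integrable_pathMeasure ht
  rw [pathMeasure, integrable_add_measure] at h
  rw [pathMeasure, integral_add_measure h.1 h.2, integral_dirac,
    intervalIntegral.integral_of_le ht]

theorem const_mul (hf : LocallyBoundedMeasurable f) (a : ℝ) :
    LocallyBoundedMeasurable fun s => a * f s :=
  (continuous_const.locallyBoundedMeasurable (f := fun _ => a)).mul hf

end LocallyBoundedMeasurable

theorem locallyBoundedMeasurable_indicator_lt (u : ℝ) :
    LocallyBoundedMeasurable fun s => if u < s then 1 else 0 where
  measurable := Measurable.ite measurableSet_Ioi measurable_const measurable_const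
  bounded R := ⟨1, fun q _ => by split_ifs <;> simp⟩

/-- The noise `N` is centered with covariance `v min(s, t)` and has continuous paths. -/
structure IsWienerNoise {Ω : Type*} [MeasurableSpace Ω] (P : Measure Ω) (v : ℝ)
    (N : ℝ → Ω → ℝ) : Prop where
  aemeasurable_uncurry : ∀ (ν : Measure ℝ) [SFinite ν],
    AEMeasurable (fun p : Ω × ℝ => N p.2 p.1) (P.prod ν)
  continuous : ∀ᵐ ω ∂P, Continuous fun t => N t ω
  memLp : ∀ t, MemLp (N t) 2 P
  mean : ∀ t, ∫ ω, N t ω ∂P = 0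
  covariance : ∀ s t, 0 ≤ s → 0 ≤ t → ∫ ω, N s ω * N t ω ∂P = v * min s t

namespace IsFundamentalSolution

variable {c δ : ℝ} {Φ : ℝ → ℝ}

theorem locallyBoundedMeasurable_responseWeight (h : IsFundamentalSolution c δ Φ) (t : ℝ) :
    LocallyBoundedMeasurable (responseWeight c δ Φ t) := by
  have hΦ := (((h.cutContinuous.locallyBoundedMeasurable.comp_sub_right δ).comp_sub_left t).const_mul
    c).const_mul (-1)
  refine ⟨Measurable.ite (measurableSet_singleton t) measurable_const ?_, fun R => ?_⟩
  · simpa using hΦ.measurable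
  · obtain ⟨M, hM⟩ := hΦ.bounded R
    refine ⟨max 1 M, fun q hq => ?_⟩
    unfold responseWeight
    split_ifs
    · simp
    · refine le_max_of_le_right ((hM q hq).trans' (le_of_eq ?_))
      congr 1; ring

theorem integral_responseWeight_mul (h : IsFundamentalSolution c δ Φ) {f : ℝ → ℝ}
    (hf : LocallyBoundedMeasurable f) {t : ℝ} (ht : 0 ≤ t) :
    ∫ s, responseWeight c δ Φ t s * f s ∂(pathMeasure t) = response c δ Φ f t := by
  rw [((h.locallyBoundedMeasurable_responseWeight t).mul hf).integral_pathMeasure ht, response,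
    ← intervalIntegral.integral_const_mul, sub_eq_add_neg, ← intervalIntegral.integral_neg]
  congr 1
  · simp [responseWeight]
  · refine intervalIntegral.integral_congr_ae ?_
    filter_upwards [(measure_eq_zero_iff_ae_notMem (s := {t})).1 Real.volume_singleton] with s hs _
    rw [responseWeight, if_neg (by simpa using hs)]
    ring

/-- A step switched on at `u` acts as an impulse in the differential equation. Together with `min s
s' = ∫ 1_{u < s} 1_{u < s'} du` this plays the role of the Itô isometry. -/
theorem response_indicator (h : IsFundamentalSolution c δ Φ) {t u : ℝ} (hu : 0 ≤ u) (hut : u < t) :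
    response c δ Φ (fun s => if u < s then 1 else 0) t = Φ (t - u) := by
  have hint := (((h.cutContinuous.locallyBoundedMeasurable.comp_sub_right δ).comp_sub_left t).mul
    (locallyBoundedMeasurable_indicator_lt u)).intervalIntegrable
  rw [← h.one_sub_integral hut.le, response, if_pos hut,
    ← intervalIntegral.integral_add_adjacent_intervals (hint 0 u) (hint u t)]
  have h1 : ∫ s in (0 : ℝ)..u, Φ (t - s - δ) * (if u < s then (1 : ℝ) else 0) = 0 := by
    refine intervalIntegral.integral_zero_ae (ae_of_all _ fun s hs => ?_)
    rw [Set.uIoc_of_le hu] at hs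
    rw [if_neg hs.2.not_gt, mul_zero]
  have h2 : ∫ s in u..t, Φ (t - s - δ) * (if u < s then (1 : ℝ) else 0)
      = ∫ s in u..t, Φ (t - s - δ) := by
    refine intervalIntegral.integral_congr_ae (ae_of_all _ fun s hs => ?_)
    rw [Set.uIoc_of_le hut.le] at hs
    rw [if_pos hs.1, mul_one]
  rw [h1, h2, zero_add]

theorem integral_indicator_mul {s s' t : ℝ} (hs : s ∈ Set.Icc 0 t) (hs' : s' ∈ Set.Icc 0 t) :
    ∫ u in Set.Ioc 0 t, (if u < s then (1 : ℝ) else 0) * (if u < s' then 1 else 0) = min s s' := by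
  have h1 : ∀ u : ℝ, (if u < s then (1 : ℝ) else 0) * (if u < s' then 1 else 0)
      = (Set.Iio (min s s')).indicator (fun _ => 1) u := by
    intro u
    simp only [Set.indicator_apply, Set.mem_Iio, lt_min_iff]
    split_ifs <;> simp_all
  have h0 : 0 ≤ min s s' := le_min hs.1 hs'.1
  have h2 : Set.Ioc 0 t ∩ Set.Iio (min s s') = Set.Ioo 0 (min s s') := by
    ext u
    simp only [Set.mem_inter_iff, Set.mem_Ioc, Set.mem_Iio, Set.mem_Ioo]
    refine ⟨fun h => ⟨h.1.1, h.2⟩, fun h => ⟨⟨h.1, ?_⟩, h.2⟩⟩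
    exact h.2.le.trans ((min_le_left _ _).trans hs.2)
  simp_rw [h1]
  rw [setIntegral_indicator measurableSet_Iio, h2]
  simp [h0]

/-- The iterated integral of the covariance kernel of the response to white noise. -/
theorem integral_min_kernel (h : IsFundamentalSolution c δ Φ) {t : ℝ} (ht : 0 ≤ t) :
    ∫ s, ∫ s', responseWeight c δ Φ t s * responseWeight c δ Φ t s' * min s s'
      ∂(pathMeasure t) ∂(pathMeasure t) = ∫ u in (0 : ℝ)..t, Φ u ^ 2 := by
  have hw := h.locallyBoundedMeasurable_responseWeight t
  have hm : Measurable (Function.uncurry fun u s : ℝ =>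
      responseWeight c δ Φ t s * (if u < s then (1 : ℝ) else 0)) :=
    (hw.measurable.comp measurable_snd).mul
      (Measurable.ite (measurableSet_lt measurable_fst measurable_snd) measurable_const
        measurable_const)
  -- The second-moment formula is read backwards, with Lebesgue measure in `u` as the measure on the
  -- sample space and the steps `1_{u < s}` as a process with covariance kernel `min`.
  rw [← integral_sq_integral (P := volume.restrict (Set.Ioc 0 t)) hm.aestronglyMeasurable ?_ ?_]
  · have h1 : ∫ u in (0 : ℝ)..t, Φ u ^ 2 = ∫ u in (0 : ℝ)..t, Φ (t - u) ^ 2 := by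
      rw [intervalIntegral.integral_comp_sub_left (fun u => Φ u ^ 2) t]
      simp
    rw [h1, ← intervalIntegral.integral_of_le ht]
    refine intervalIntegral.integral_congr_ae ?_
    filter_upwards [(measure_eq_zero_iff_ae_notMem (s := {t})).1 Real.volume_singleton] with u hne hu
    rw [Set.uIoc_of_le ht] at hu
    rw [h.integral_responseWeight_mul (locallyBoundedMeasurable_indicator_lt u) ht,
      h.response_indicator hu.1.le (lt_of_le_of_ne hu.2 hne)]
  · refine (((hw.mul hw).integrable_pathMeasure ht).comp_snd _).mono'
      (hm.pow_const 2).aestronglyMeasurable (ae_of_all _ fun p => ?_)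
    rw [Real.norm_eq_abs, abs_of_nonneg (sq_nonneg _)]
    split_ifs
    · exact le_of_eq (by ring)
    · simpa using mul_self_nonneg _
  · filter_upwards [ae_pathMeasure_mem ht] with s hs
    filter_upwards [ae_pathMeasure_mem ht] with s' hs'
    rw [← integral_indicator_mul hs hs', ← integral_const_mul]
    congr 1
    ext u
    ring

section Noise

variable {Ω : Type*} [MeasurableSpace Ω] {P : Measure Ω} {v t : ℝ} {N : ℝ → Ω → ℝ}

theorem aestronglyMeasurable_weight_mul_noise [SFinite P] (h : IsFundamentalSolution c δ Φ)
    (hN : IsWienerNoise P v N) :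
    AEStronglyMeasurable (Function.uncurry fun ω s => responseWeight c δ Φ t s * N s ω)
      (P.prod (pathMeasure t)) :=
  (((h.locallyBoundedMeasurable_responseWeight t).measurable.comp measurable_snd).aemeasurable.mul
    (hN.aemeasurable_uncurry _)).aestronglyMeasurable

theorem integrable_sq_weight_mul_noise [IsProbabilityMeasure P] (h : IsFundamentalSolution c δ Φ)
    (hN : IsWienerNoise P v N) (ht : 0 ≤ t) :
    Integrable (fun p : Ω × ℝ => (responseWeight c δ Φ t p.2 * N p.2 p.1) ^ 2)
      (P.prod (pathMeasure t)) := by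
  have hw := h.locallyBoundedMeasurable_responseWeight t
  refine (integrable_prod_iff' ((h.aestronglyMeasurable_weight_mul_noise hN).pow 2)).2 ⟨?_, ?_⟩
  · refine ae_of_all _ fun s => ?_
    exact ((hN.memLp s).integrable_sq.const_mul (responseWeight c δ Φ t s ^ 2)).congr
      (ae_of_all _ fun ω => (mul_pow _ _ _).symm)
  · refine (((hw.mul hw).mul (continuous_const_mul v).locallyBoundedMeasurable
      ).integrable_pathMeasure ht).congr ?_
    filter_upwards [ae_pathMeasure_mem ht] with s hs
    have h1 := hN.covariance s s hs.1 hs.1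
    rw [min_self] at h1
    change responseWeight c δ Φ t s * responseWeight c δ Φ t s * (v * s)
      = ∫ ω, ‖(responseWeight c δ Φ t s * N s ω) ^ 2‖ ∂P
    rw [← h1, ← integral_const_mul]
    congr 1
    ext ω
    rw [Real.norm_eq_abs, abs_of_nonneg (sq_nonneg _)]
    ring

theorem response_noise_ae_eq (h : IsFundamentalSolution c δ Φ)
    (hN : IsWienerNoise P v N) (ht : 0 ≤ t) :
    (fun ω => ∫ s, responseWeight c δ Φ t s * N s ω ∂(pathMeasure t))
      =ᵐ[P] fun ω => response c δ Φ (fun s => N s ω) t := by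
  filter_upwards [hN.continuous] with ω hω
  exact h.integral_responseWeight_mul hω.locallyBoundedMeasurable ht

theorem memLp_response_noise [IsProbabilityMeasure P] (h : IsFundamentalSolution c δ Φ)
    (hN : IsWienerNoise P v N) (ht : 0 ≤ t) :
    MemLp (fun ω => response c δ Φ (fun s => N s ω) t) 2 P := by
  refine (memLp_congr_ae (h.response_noise_ae_eq hN ht)).1 ?_
  have hZ := h.aestronglyMeasurable_weight_mul_noise (t := t) hN
  exact (memLp_two_iff_integrable_sq hZ.integral_prod_right').2 <|
    integrable_sq_integral hZ (h.integrable_sq_weight_mul_noise hN ht)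

theorem integral_response_noise [IsProbabilityMeasure P] (h : IsFundamentalSolution c δ Φ)
    (hN : IsWienerNoise P v N) (ht : 0 ≤ t) :
    ∫ ω, response c δ Φ (fun s => N s ω) t ∂P = 0 := by
  have hZ := h.aestronglyMeasurable_weight_mul_noise (t := t) hN
  rw [← integral_congr_ae (h.response_noise_ae_eq hN ht), integral_integral_swap]
  · simp [integral_const_mul, hN.mean]
  · exact ((memLp_two_iff_integrable_sq hZ).2
      (h.integrable_sq_weight_mul_noise hN ht)).integrable one_le_two

theorem integral_sq_response_noise [IsProbabilityMeasure P] (h : IsFundamentalSolution c δ Φ)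
    (hN : IsWienerNoise P v N) (ht : 0 ≤ t) :
    ∫ ω, response c δ Φ (fun s => N s ω) t ^ 2 ∂P = v * ∫ u in (0 : ℝ)..t, Φ u ^ 2 := by
  have hZ := h.aestronglyMeasurable_weight_mul_noise (t := t) hN
  have h1 : (fun ω => (∫ s, responseWeight c δ Φ t s * N s ω ∂(pathMeasure t)) ^ 2)
      =ᵐ[P] fun ω => response c δ Φ (fun s => N s ω) t ^ 2 := by
    filter_upwards [h.response_noise_ae_eq hN ht] with ω hω
    rw [hω]
  rw [← integral_congr_ae h1, ← h.integral_min_kernel ht,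
    integral_sq_integral hZ (h.integrable_sq_weight_mul_noise hN ht) (K := fun s s' =>
      v * (responseWeight c δ Φ t s * responseWeight c δ Φ t s' * min s s'))]
  · simp_rw [integral_const_mul]
  · filter_upwards [ae_pathMeasure_mem ht] with s hs
    filter_upwards [ae_pathMeasure_mem ht] with s' hs'
    have h2 := hN.covariance s s' hs.1 hs'.1
    calc _ = ∫ ω, responseWeight c δ Φ t s * responseWeight c δ Φ t s' * (N s ω * N s' ω) ∂P := by
          congr 1; ext ω; ring
      _ = _ := by rw [integral_const_mul, h2]; ring

/-- The response is linear in the forcing, and `one_sub_integral` at `u = 0` evaluates it on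
constants. Path continuity is needed to split the integral. -/
theorem response_const_add_noise_ae_eq (h : IsFundamentalSolution c δ Φ)
    (hN : IsWienerNoise P v N) (ht : 0 ≤ t) (x₀ : ℝ) :
    (fun ω => x₀ * Φ t + response c δ Φ (fun s => N s ω) t)
      =ᵐ[P] fun ω => response c δ Φ (fun s => x₀ + N s ω) t := by
  have hΦ := (h.cutContinuous.locallyBoundedMeasurable.comp_sub_right δ).comp_sub_left t
  filter_upwards [hN.continuous] with ω hω
  have h2 := (hΦ.const_mul x₀).intervalIntegrable 0 t
  have h3 := (hΦ.mul hω.locallyBoundedMeasurable).intervalIntegrable 0 t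
  have h4 : ∫ s in (0 : ℝ)..t, Φ (t - s - δ) * (x₀ + N s ω)
      = x₀ * (∫ s in (0 : ℝ)..t, Φ (t - s - δ)) + ∫ s in (0 : ℝ)..t, Φ (t - s - δ) * N s ω := by
    rw [← intervalIntegral.integral_const_mul, ← intervalIntegral.integral_add h2 h3]
    congr 1; ext s; ring
  have h5 := h.one_sub_integral ht
  rw [sub_zero] at h5
  rw [response, response, h4, ← h5]
  ring

theorem _root_.MeasureTheory.integral_const_add_sq_of_integral_eq_zero [IsProbabilityMeasure P]
    {Y : Ω → ℝ} (hY : MemLp Y 2 P) (h0 : ∫ ω, Y ω ∂P = 0) (a : ℝ) :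
    ∫ ω, (a + Y ω) ^ 2 ∂P = a ^ 2 + ∫ ω, Y ω ^ 2 ∂P := by
  have h3 : ∀ ω, (a + Y ω) ^ 2 = a ^ 2 + 2 * a * Y ω + Y ω ^ 2 := fun ω => by ring
  have hi : Integrable (fun ω => 2 * a * Y ω) P := (hY.integrable one_le_two).const_mul (2 * a)
  have hc : Integrable (fun _ : Ω => a ^ 2) P := integrable_const _
  simp_rw [h3]
  rw [integral_add (f := fun ω => a ^ 2 + 2 * a * Y ω) (hc.add hi) hY.integrable_sq,
    integral_add hc hi, integral_const_mul, h0]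
  simp

/-- The second moment of a solution of the scalar delay equation driven by white noise. -/
theorem memLp_response_const_add_noise [IsProbabilityMeasure P] (h : IsFundamentalSolution c δ Φ)
    (hN : IsWienerNoise P v N) (ht : 0 ≤ t) (x₀ : ℝ) :
    MemLp (fun ω => response c δ Φ (fun s => x₀ + N s ω) t) 2 P := by
  have h1 : MemLp (fun ω => x₀ * Φ t + response c δ Φ (fun s => N s ω) t) 2 P :=
    MemLp.add (f := fun _ => x₀ * Φ t) (memLp_const _) (h.memLp_response_noise hN ht)
  exact h1.ae_eq (h.response_const_add_noise_ae_eq hN ht x₀)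

theorem integral_sq_response_const_add_noise [IsProbabilityMeasure P]
    (h : IsFundamentalSolution c δ Φ) (hN : IsWienerNoise P v N) (ht : 0 ≤ t) (x₀ : ℝ) :
    ∫ ω, response c δ Φ (fun s => x₀ + N s ω) t ^ 2 ∂P
      = x₀ ^ 2 * Φ t ^ 2 + v * ∫ u in (0 : ℝ)..t, Φ u ^ 2 := by
  have h2 : (fun ω => (x₀ * Φ t + response c δ Φ (fun s => N s ω) t) ^ 2)
      =ᵐ[P] fun ω => response c δ Φ (fun s => x₀ + N s ω) t ^ 2 := by
    filter_upwards [h.response_const_add_noise_ae_eq hN ht x₀] with ω hω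
    rw [hω]
  rw [← integral_congr_ae h2, integral_const_add_sq_of_integral_eq_zero
    (h.memLp_response_noise hN ht) (h.integral_response_noise hN ht),
    h.integral_sq_response_noise hN ht, mul_pow]

end Noise

end IsFundamentalSolution

/-! ### Brownian forcing -/

section Brownian

variable {Ω K : Type*} [MeasurableSpace Ω] {P : Measure Ω} [DecidableEq K] {W : K → ℝ≥0 → Ω → ℝ}

theorem memLp_two_brownian {X : ℝ≥0 → Ω → ℝ} (hX : IsBrownianReal X P) (t : ℝ≥0) :
    MemLp (X t) 2 P :=
  (hX.toIsPreBrownianReal.isGaussianProcess.hasGaussianLaw_eval t).memLp_two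

theorem integral_mul_brownian [IsProbabilityMeasure P] (hW : ∀ k, IsBrownianReal (W k) P)
    (hind : iIndepFun (fun k ω t => W k t ω) P) (k l : K) (s t : ℝ≥0) :
    ∫ ω, W k s ω * W l t ω ∂P = if k = l then ((min s t : ℝ≥0) : ℝ) else 0 := by
  have hcov : cov[W k s, W l t; P] = ∫ ω, W k s ω * W l t ω ∂P := by
    rw [covariance_eq_sub (memLp_two_brownian (hW k) s) (memLp_two_brownian (hW l) t),
      (hW k).toIsPreBrownianReal.integral_eval, zero_mul, sub_zero]
    rfl
  rw [← hcov]
  split_ifs with h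
  · subst h
    exact (hW k).toIsPreBrownianReal.covariance_eval s t
  · have h1 : IndepFun (W k s) (W l t) P :=
      (hind.indepFun h).comp (measurable_pi_apply s) (measurable_pi_apply t)
    exact h1.covariance_eq_zero (memLp_two_brownian (hW k) s) (memLp_two_brownian (hW l) t)

/-- Linear combinations of independent Brownian motions are Wiener noise. -/
theorem isWienerNoise_sum [IsProbabilityMeasure P] [Fintype K] (hW : ∀ k, IsBrownianReal (W k) P)
    (hind : iIndepFun (fun k ω t => W k t ω) P) (a : K → ℝ) :
    IsWienerNoise P (∑ k, a k ^ 2) fun t ω => ∑ k, a k * W k t.toNNReal ω where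
  aemeasurable_uncurry ν _ := by
    refine Finset.aemeasurable_fun_sum _ fun k _ => AEMeasurable.const_mul ?_ _
    exact aemeasurable_uncurry_of_ae_continuous
      (fun t => (hW k).toIsPreBrownianReal.aemeasurable t) (hW k).cont ν
  continuous := by
    filter_upwards [ae_all_iff.2 fun k => (hW k).cont] with ω hω
    refine continuous_finsetSum _ fun k _ => continuous_const.mul ?_
    exact (hω k).comp continuous_real_toNNReal
  memLp t := memLp_finsetSum _ fun k _ => (memLp_two_brownian (hW k) _).const_mul _
  mean t := by
    rw [integral_finsetSum _ fun k _ =>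
      ((hW k).toIsPreBrownianReal.integrable_eval _).const_mul _]
    simp [integral_const_mul, (hW _).toIsPreBrownianReal.integral_eval]
  covariance s t hs ht := by
    have hint : ∀ k l, Integrable (fun ω =>
        a k * a l * (W k s.toNNReal ω * W l t.toNNReal ω)) P := fun k l =>
      ((memLp_two_brownian (hW k) _).integrable_mul (memLp_two_brownian (hW l) _)).const_mul _
    have h1 : ∀ ω, (∑ k, a k * W k s.toNNReal ω) * (∑ k, a k * W k t.toNNReal ω)
        = ∑ k, ∑ l, a k * a l * (W k s.toNNReal ω * W l t.toNNReal ω) := by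
      intro ω
      rw [Finset.sum_mul_sum]
      exact Finset.sum_congr rfl fun k _ => Finset.sum_congr rfl fun l _ => by ring
    simp_rw [h1]
    rw [integral_finsetSum _ fun k _ => integrable_finsetSum _ fun l _ => hint k l]
    simp_rw [integral_finsetSum _ fun l _ => hint _ l, integral_const_mul,
      integral_mul_brownian hW hind]
    simp only [mul_ite, mul_zero, Finset.sum_ite_eq, Finset.mem_univ, if_true, Finset.sum_mul]
    refine Finset.sum_congr rfl fun k _ => ?_
    push_cast
    rw [Real.coe_toNNReal s hs, Real.coe_toNNReal t ht]
    ring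

end Brownian

/-! ### The spectrum of the weighted Laplacian -/

section Graph

open Matrix

section Adjacency

variable {V : Type*} (G : SimpleGraph V) [DecidableRel G.Adj] (w : Sym2 V → ℝ)

theorem wAdj_symm (i j : V) : wAdj G w i j = wAdj G w j i := by
  simp [wAdj, G.adj_comm i j, Sym2.eq_swap]

variable {G w}

theorem wAdj_nonneg (hw : ∀ e ∈ G.edgeSet, 0 < w e) (i j : V) : 0 ≤ wAdj G w i j := by
  simp only [wAdj, of_apply]
  split_ifs with h
  · exact (hw _ h).le
  · exact le_rfl

end Adjacency

variable {V : Type*} [Fintype V] [DecidableEq V]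

theorem centering_mulVec_apply (y : V → ℝ) (i : V) :
    (centering V *ᵥ y) i = y i - (Fintype.card V : ℝ)⁻¹ * ∑ k, y k := by
  rw [centering, sub_mulVec, one_mulVec, smul_mulVec]
  simp [mulVec, dotProduct]

theorem dotProduct_centering (q y : V → ℝ) :
    q ⬝ᵥ centering V *ᵥ y = q ⬝ᵥ y - (Fintype.card V : ℝ)⁻¹ * (∑ i, q i) * ∑ i, y i := by
  simp only [dotProduct, centering_mulVec_apply, mul_sub, Finset.sum_sub_distrib]
  rw [← Finset.sum_mul]
  ring

variable (G : SimpleGraph V) [DecidableRel G.Adj] (w : Sym2 V → ℝ)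

theorem wLap_mulVec_apply (y : V → ℝ) (i : V) :
    (wLap G w *ᵥ y) i = ∑ j, wAdj G w i j * (y i - y j) := by
  rw [wLap, sub_mulVec, Pi.sub_apply, wDeg, mulVec_diagonal]
  simp only [mulVec, dotProduct, mul_sub, Finset.sum_sub_distrib, Finset.sum_mul]

theorem dotProduct_wLap_mulVec (x y : V → ℝ) :
    x ⬝ᵥ wLap G w *ᵥ y = (wLap G w *ᵥ x) ⬝ᵥ y := by
  have h : (wLap G w)ᵀ = wLap G w := by
    simpa using (wLap_isHermitian G w).eq
  rw [dotProduct_mulVec, ← mulVec_transpose, h]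

theorem dotProduct_wLap_mulVec_self (y : V → ℝ) :
    y ⬝ᵥ wLap G w *ᵥ y = 1 / 2 * ∑ i, ∑ j, wAdj G w i j * (y i - y j) ^ 2 := by
  have h1 : y ⬝ᵥ wLap G w *ᵥ y = ∑ i, ∑ j, wAdj G w i j * (y i * (y i - y j)) := by
    simp only [dotProduct, wLap_mulVec_apply, Finset.mul_sum]
    exact Finset.sum_congr rfl fun i _ => Finset.sum_congr rfl fun j _ => by ring
  have h2 : y ⬝ᵥ wLap G w *ᵥ y = ∑ i, ∑ j, wAdj G w i j * (y j * (y j - y i)) := by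
    rw [h1, Finset.sum_comm]
    exact Finset.sum_congr rfl fun i _ => Finset.sum_congr rfl fun j _ => by rw [wAdj_symm]
  -- Adding the two expansions, which differ by exchanging `i` and `j`, completes the square on each
  -- edge.
  have h3 : ∑ i, ∑ j, wAdj G w i j * (y i - y j) ^ 2 = y ⬝ᵥ wLap G w *ᵥ y + y ⬝ᵥ wLap G w *ᵥ y := by
    nth_rw 1 [h1]
    rw [h2, ← Finset.sum_add_distrib]
    refine Finset.sum_congr rfl fun i _ => ?_
    rw [← Finset.sum_add_distrib]
    exact Finset.sum_congr rfl fun j _ => by ring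
  rw [h3]; ring

variable {G w}

/-- Zero Dirichlet energy makes every edge term vanish, and walks carry equality from edge to edge.
-/
theorem eq_of_dotProduct_wLap_mulVec_self_eq_zero (hG : G.Connected)
    (hw : ∀ e ∈ G.edgeSet, 0 < w e) {y : V → ℝ} (hy : y ⬝ᵥ wLap G w *ᵥ y = 0) (i j : V) :
    y i = y j := by
  rw [dotProduct_wLap_mulVec_self] at hy
  have h0 : ∀ i j, 0 ≤ wAdj G w i j * (y i - y j) ^ 2 := fun i j =>
    mul_nonneg (wAdj_nonneg hw i j) (sq_nonneg _)
  have h1 : ∀ i j, wAdj G w i j * (y i - y j) ^ 2 = 0 := by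
    intro i j
    have h2 : ∑ i, ∑ j, wAdj G w i j * (y i - y j) ^ 2 = 0 := by linarith
    have h3 := (Finset.sum_eq_zero_iff_of_nonneg fun i _ => Finset.sum_nonneg fun j _ => h0 i j).1
      h2 i (Finset.mem_univ i)
    exact (Finset.sum_eq_zero_iff_of_nonneg fun j _ => h0 i j).1 h3 j (Finset.mem_univ j)
  have h2 : ∀ i j, G.Adj i j → y i = y j := by
    intro i j hij
    have h3 := h1 i j
    have h4 : 0 < w s(i, j) := hw _ (G.mem_edgeSet.2 hij)
    simp only [wAdj, of_apply, if_pos hij, mul_eq_zero, h4.ne', false_or] at h3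
    exact sub_eq_zero.1 (pow_eq_zero_iff two_ne_zero |>.1 h3)
  obtain ⟨p⟩ := hG.preconnected i j
  induction p with
  | nil => rfl
  | cons hadj _ ih => exact (h2 _ _ hadj).trans ih

variable (G w) in
/-- The `j`-th vector of an orthonormal eigenbasis of the Laplacian. -/
noncomputable def lapMode (j : V) : V → ℝ := (wLap_isHermitian G w).eigenvectorBasis j

variable (G w) in
/-- The eigenvalue of `lapMode G w j`. -/
noncomputable def lapEigenvalue (j : V) : ℝ := (wLap_isHermitian G w).eigenvalues j

theorem wLap_mulVec_lapMode (j : V) :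
    wLap G w *ᵥ lapMode G w j = lapEigenvalue G w j • lapMode G w j :=
  (wLap_isHermitian G w).mulVec_eigenvectorBasis j

theorem lapMode_dotProduct_wLap_mulVec (j : V) (y : V → ℝ) :
    lapMode G w j ⬝ᵥ wLap G w *ᵥ y = lapEigenvalue G w j * (lapMode G w j ⬝ᵥ y) := by
  rw [dotProduct_wLap_mulVec, wLap_mulVec_lapMode, smul_dotProduct, smul_eq_mul]

theorem dotProduct_self_eq_sum_sq_lapMode (y : V → ℝ) :
    y ⬝ᵥ y = ∑ j, (lapMode G w j ⬝ᵥ y) ^ 2 := by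
  have h := (wLap_isHermitian G w).eigenvectorBasis.sum_sq_norm_inner_right (WithLp.toLp 2 y)
  rw [EuclideanSpace.norm_sq_eq] at h
  simp only [PiLp.inner_apply, Real.norm_eq_abs, sq_abs] at h
  simp only [dotProduct, lapMode]
  rw [Finset.sum_congr rfl fun i _ => (sq (y i)).symm, ← h]
  refine Finset.sum_congr rfl fun j _ => ?_
  congr 1
  refine Finset.sum_congr rfl fun i _ => ?_
  simp [mul_comm]

theorem lapMode_dotProduct_self (j : V) : lapMode G w j ⬝ᵥ lapMode G w j = 1 := by
  have h := (wLap_isHermitian G w).eigenvectorBasis.norm_eq_one j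
  have h2 : ‖(wLap_isHermitian G w).eigenvectorBasis j‖ ^ 2 = 1 := by rw [h]; norm_num
  rw [EuclideanSpace.norm_sq_eq] at h2
  simpa [dotProduct, lapMode, ← sq] using h2

theorem lapEigenvalue_nonneg (hw : ∀ e ∈ G.edgeSet, 0 < w e) (j : V) : 0 ≤ lapEigenvalue G w j := by
  have h := lapMode_dotProduct_wLap_mulVec (G := G) (w := w) j (lapMode G w j)
  rw [lapMode_dotProduct_self, mul_one, dotProduct_wLap_mulVec_self] at h
  rw [← h]
  exact mul_nonneg (by norm_num) (Finset.sum_nonneg fun i _ => Finset.sum_nonneg fun j _ =>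
    mul_nonneg (wAdj_nonneg hw _ _) (sq_nonneg _))

/-- Constants lie in the kernel of `L`, so by symmetry this mode is orthogonal to them. -/
theorem lapMode_dotProduct_centering_of_ne_zero {j : V} (hj : lapEigenvalue G w j ≠ 0)
    (y : V → ℝ) : lapMode G w j ⬝ᵥ centering V *ᵥ y = lapMode G w j ⬝ᵥ y := by
  have h := lapMode_dotProduct_wLap_mulVec (G := G) (w := w) j fun _ => 1
  have h1 : wLap G w *ᵥ (fun _ => 1) = 0 := by
    ext i; simp [wLap_mulVec_apply]
  rw [h1, dotProduct_zero, eq_comm, mul_eq_zero, or_iff_right hj] at h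
  have h2 : ∑ i, lapMode G w j i = 0 := by simpa [dotProduct] using h
  rw [dotProduct_centering, h2]
  ring

/-- Such a mode has zero Dirichlet energy, so it is constant, and centered vectors sum to zero. -/
theorem lapMode_dotProduct_centering_of_eq_zero [Nonempty V] (hG : G.Connected)
    (hw : ∀ e ∈ G.edgeSet, 0 < w e) {j : V} (hj : lapEigenvalue G w j = 0)
    (y : V → ℝ) : lapMode G w j ⬝ᵥ centering V *ᵥ y = 0 := by
  have h := lapMode_dotProduct_wLap_mulVec (G := G) (w := w) j (lapMode G w j)
  rw [hj, zero_mul] at h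
  have h1 := eq_of_dotProduct_wLap_mulVec_self_eq_zero hG hw h
  obtain ⟨i₀⟩ := ‹Nonempty V›
  have h2 : lapMode G w j = fun _ => lapMode G w j i₀ := funext fun i => h1 i i₀
  have h3 : (Fintype.card V : ℝ) ≠ 0 := by
    have : Nonempty V := ⟨i₀⟩
    exact_mod_cast Fintype.card_ne_zero
  rw [dotProduct_centering, h2]
  simp only [dotProduct, ← Finset.mul_sum, Finset.sum_const, Finset.card_univ, nsmul_eq_mul]
  field_simp
  simp

/-- Otherwise Parseval would give `M b = 0`, making `b` equal to its mean everywhere. -/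
theorem exists_lapMode_dotProduct_centering_ne_zero {b : V → ℝ} {i i' : V} (hb : b i ≠ b i') :
    ∃ j, lapMode G w j ⬝ᵥ centering V *ᵥ b ≠ 0 := by
  by_contra! h
  have h1 := dotProduct_self_eq_sum_sq_lapMode (G := G) (w := w) (centering V *ᵥ b)
  simp only [h, ne_eq, OfNat.ofNat_ne_zero, not_false_eq_true, zero_pow, Finset.sum_const_zero,
    dotProduct_self_eq_zero] at h1
  have h2 := congrFun h1 i
  have h3 := congrFun h1 i'
  rw [centering_mulVec_apply, Pi.zero_apply] at h2 h3
  exact hb (by linarith)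

end Graph

/-! ### Performance and centrality of noisy networks -/

/-- The stationary variance `cos (λτ) / (2λ (1 - sin (λτ)))` of a mode with eigenvalue `λ > 0` driven
by a unit white noise. -/
noncomputable def modalGain (l τ : ℝ) : ℝ :=
  Real.cos (l * τ) / (2 * l * (1 - Real.sin (l * τ)))

theorem sin_lt_one_of_mem {x : ℝ} (h0 : 0 ≤ x) (h1 : x < Real.pi / 2) : Real.sin x < 1 := by
  rw [← Real.sin_pi_div_two]
  exact Real.sin_lt_sin_of_lt_of_le_pi_div_two (by linarith [Real.pi_pos]) le_rfl h1

/-- In the quotient rule, `cos² - sin (1 - sin) = 1 - sin` cancels one factor of the denominator. -/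
theorem hasDerivAt_modalGain {l τ : ℝ} (hl : l ≠ 0) (h : Real.sin (l * τ) < 1) :
    HasDerivAt (modalGain l) (1 / 2 * (1 / (1 - Real.sin (l * τ)))) τ := by
  have h1 : 1 - Real.sin (l * τ) ≠ 0 := by linarith
  have hlin : HasDerivAt (fun x => l * x) l τ := by
    simpa using (hasDerivAt_id τ).const_mul l
  have hden : HasDerivAt (fun x => 2 * l * (1 - Real.sin (l * x)))
      (2 * l * (-(Real.cos (l * τ) * l))) τ := (hlin.sin.const_sub 1).const_mul (2 * l)
  refine (hlin.cos.div hden (by positivity)).congr_deriv ?_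
  field_simp
  linear_combination Real.sin_sq_add_cos_sq (l * τ)

namespace NoisyNetwork

open Matrix

variable {V K : Type*} [Fintype V] [DecidableEq V] [Fintype K]
  {G : SimpleGraph V} [DecidableRel G.Adj] {w : Sym2 V → ℝ} {B : Matrix V K ℝ}
  (N : NoisyNetwork.{u} (wLap G w) B) {τ : ℝ} {v : K → ℝ}

theorem continuousOn_mode (hτ : 0 ≤ τ) (hv : ∀ k, 0 ≤ v k) (j : V) :
    ∀ᵐ ω ∂N.P, ContinuousOn (fun t => lapMode G w j ⬝ᵥ N.x τ v t ω) (Set.Ici 0) := by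
  filter_upwards [(N.solution τ v hτ hv).continuousOn] with ω hω
  have : Continuous fun y : V → ℝ => lapMode G w j ⬝ᵥ y := by
    unfold dotProduct; fun_prop
  exact this.comp_continuousOn hω

theorem mode_equation (hτ : 0 ≤ τ) (hv : ∀ k, 0 ≤ v k) (j : V) :
    ∀ᵐ ω ∂N.P, ∀ t, 0 ≤ t → lapMode G w j ⬝ᵥ N.x τ v t ω
      = (lapMode G w j ⬝ᵥ N.x₀
          + ∑ k, (√(v k) * (lapMode G w j ⬝ᵥ fun a => B a k)) * N.W k t.toNNReal ω)
        - lapEigenvalue G w j * ∫ s in (0 : ℝ)..t, lapMode G w j ⬝ᵥ N.x τ v (s - τ) ω := by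
  have hsol := N.solution τ v hτ hv
  filter_upwards [hsol.continuousOn, hsol.history, hsol.equation] with ω hc hh he t ht
  have hcoord : ∀ i, IntervalIntegrable (fun s => N.x τ v (s - τ) ω i) volume 0 t := by
    intro i
    -- The state is only controlled from `-τ` on; the cut-off agrees with it there and is
    -- integrable.
    have h1 : CutContinuous ((Set.Ici 0).indicator fun s => N.x τ v s ω i) := by
      refine CutContinuous.of_continuousOn ?_ fun s hs =>
        Set.indicator_of_notMem (by simpa using hs) _
      refine ContinuousOn.congr ((continuous_apply i).comp_continuousOn hc) fun s hs => ?_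
      exact Set.indicator_of_mem hs _
    refine ((h1.comp_sub τ).intervalIntegrable 0 t).congr fun s hs => ?_
    rw [Set.uIoc_of_le ht] at hs
    simp only [Set.indicator_apply, Set.mem_Ici]
    split_ifs with h0
    · rfl
    · rw [hh _ ⟨by linarith [hs.1], by linarith⟩, Pi.zero_apply]
  have hL : ∀ i, IntervalIntegrable (fun s => (wLap G w *ᵥ N.x τ v (s - τ) ω) i) volume 0 t := by
    intro i
    simp only [mulVec, dotProduct]
    have h1 := IntervalIntegrable.sum Finset.univ
      fun k _ => (hcoord k).const_mul (wLap G w i k)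
    simpa only [Finset.sum_fn] using h1
  rw [← intervalIntegral.integral_const_mul]
  simp_rw [← lapMode_dotProduct_wLap_mulVec]
  have h1 : ∫ s in (0 : ℝ)..t, lapMode G w j ⬝ᵥ wLap G w *ᵥ N.x τ v (s - τ) ω
      = ∑ i, lapMode G w j i * ∫ s in (0 : ℝ)..t, (wLap G w *ᵥ N.x τ v (s - τ) ω) i := by
    simp only [dotProduct]
    rw [intervalIntegral.integral_finsetSum fun i _ => (hL i).const_mul _]
    simp_rw [intervalIntegral.integral_const_mul]
  have h2 : ∑ k, (√(v k) * (lapMode G w j ⬝ᵥ fun a => B a k)) * N.W k t.toNNReal ω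
      = ∑ i, lapMode G w j i * ∑ k, B i k * (√(v k) * N.W k t.toNNReal ω) := by
    simp only [dotProduct, Finset.mul_sum, Finset.sum_mul]
    rw [Finset.sum_comm]
    exact Finset.sum_congr rfl fun i _ => Finset.sum_congr rfl fun k _ => by ring
  rw [h1, h2]
  simp only [dotProduct]
  rw [← Finset.sum_add_distrib, ← Finset.sum_sub_distrib]
  refine Finset.sum_congr rfl fun i _ => ?_
  rw [he t ht i]
  ring

theorem outputSq_eq_sum (t : ℝ) (ω : N.Ω) :
    N.outputSq τ v t ω = ∑ j, (lapMode G w j ⬝ᵥ centering V *ᵥ N.x τ v t ω) ^ 2 :=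
  dotProduct_self_eq_sum_sq_lapMode _

theorem mode_ae_eq_response {Φ : ℝ → ℝ} {j : V}
    (hΦ : IsFundamentalSolution (lapEigenvalue G w j) τ Φ)
    (hτ : 0 ≤ τ) (hv : ∀ k, 0 ≤ v k) {t : ℝ} (ht : 0 ≤ t) :
    (fun ω => response (lapEigenvalue G w j) τ Φ (fun s => lapMode G w j ⬝ᵥ N.x₀
        + ∑ k, (√(v k) * (lapMode G w j ⬝ᵥ fun a => B a k)) * N.W k s.toNNReal ω) t)
      =ᵐ[N.P] fun ω => lapMode G w j ⬝ᵥ N.x τ v t ω := by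
  filter_upwards [N.continuousOn_mode hτ hv j, (N.solution τ v hτ hv).history,
    N.mode_equation hτ hv j] with ω hc hh he
  refine (hΦ.representation hτ hc (fun s hs => ?_) he ht).symm
  rw [hh s hs, dotProduct_zero]

variable [DecidableEq K]

theorem integrable_sq_mode (hτ : 0 ≤ τ) (hv : ∀ k, 0 ≤ v k) (j : V) {t : ℝ} (ht : 0 ≤ t) :
    Integrable (fun ω => (lapMode G w j ⬝ᵥ N.x τ v t ω) ^ 2) N.P := by
  have hΦ := isFundamentalSolution_fundamentalSolution (c := lapEigenvalue G w j) hτ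
  exact ((hΦ.memLp_response_const_add_noise (isWienerNoise_sum N.brownian N.indep _) ht _).ae_eq
    (N.mode_ae_eq_response hΦ hτ hv ht)).integrable_sq

theorem integral_sq_mode {Φ : ℝ → ℝ} {j : V}
    (hΦ : IsFundamentalSolution (lapEigenvalue G w j) τ Φ)
    (hτ : 0 ≤ τ) (hv : ∀ k, 0 ≤ v k) {t : ℝ} (ht : 0 ≤ t) :
    ∫ ω, (lapMode G w j ⬝ᵥ N.x τ v t ω) ^ 2 ∂N.P
      = (lapMode G w j ⬝ᵥ N.x₀) ^ 2 * Φ t ^ 2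
        + (∑ k, v k * (lapMode G w j ⬝ᵥ fun a => B a k) ^ 2) * ∫ u in (0 : ℝ)..t, Φ u ^ 2 := by
  have h1 := hΦ.integral_sq_response_const_add_noise
    (isWienerNoise_sum N.brownian N.indep
      fun k => √(v k) * (lapMode G w j ⬝ᵥ fun a => B a k)) ht (lapMode G w j ⬝ᵥ N.x₀)
  have h2 : ∑ k, (√(v k) * (lapMode G w j ⬝ᵥ fun a => B a k)) ^ 2
      = ∑ k, v k * (lapMode G w j ⬝ᵥ fun a => B a k) ^ 2 :=
    Finset.sum_congr rfl fun k _ => by rw [mul_pow, Real.sq_sqrt (hv k)]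
  rw [h2] at h1
  rw [← h1]
  refine integral_congr_ae ?_
  filter_upwards [N.mode_ae_eq_response hΦ hτ hv ht] with ω hω
  rw [← hω]

theorem tendsto_integral_sq_mode (hτ : 0 ≤ τ) (hv : ∀ k, 0 ≤ v k) {j : V}
    (hj : 0 < lapEigenvalue G w j) (hjτ : lapEigenvalue G w j * τ < Real.pi / 2) :
    Tendsto (fun t => ∫ ω, (lapMode G w j ⬝ᵥ N.x τ v t ω) ^ 2 ∂N.P) atTop
      (𝓝 ((∑ k, v k * (lapMode G w j ⬝ᵥ fun a => B a k) ^ 2)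
        * modalGain (lapEigenvalue G w j) τ)) := by
  have hΦ := isFundamentalSolution_fundamentalSolution (c := lapEigenvalue G w j) hτ
  have h1 := (((hΦ.tendsto_zero hj hτ hjτ).pow 2).const_mul ((lapMode G w j ⬝ᵥ N.x₀) ^ 2)).add
    ((hΦ.tendsto_integral_sq hj hτ hjτ).const_mul
      (∑ k, v k * (lapMode G w j ⬝ᵥ fun a => B a k) ^ 2))
  simp only [ne_eq, OfNat.ofNat_ne_zero, not_false_eq_true, zero_pow, mul_zero, zero_add] at h1
  refine h1.congr' ?_
  filter_upwards [eventually_ge_atTop 0] with t ht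
  exact (N.integral_sq_mode hΦ hτ hv ht).symm

section Connected

variable [Nonempty V]

theorem integrable_sq_centered_mode (hG : G.Connected) (hw : ∀ e ∈ G.edgeSet, 0 < w e)
    (hτ : 0 ≤ τ) (hv : ∀ k, 0 ≤ v k) (j : V) {t : ℝ} (ht : 0 ≤ t) :
    Integrable (fun ω => (lapMode G w j ⬝ᵥ centering V *ᵥ N.x τ v t ω) ^ 2) N.P := by
  by_cases hj : lapEigenvalue G w j = 0
  · simp [lapMode_dotProduct_centering_of_eq_zero hG hw hj]
  · simp_rw [lapMode_dotProduct_centering_of_ne_zero hj]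
    exact N.integrable_sq_mode hτ hv j ht

theorem integrable_outputSq (hG : G.Connected) (hw : ∀ e ∈ G.edgeSet, 0 < w e)
    (hτ : 0 ≤ τ) (hv : ∀ k, 0 ≤ v k) {t : ℝ} (ht : 0 ≤ t) :
    Integrable (N.outputSq τ v t) N.P := by
  have : N.outputSq τ v t
      = fun ω => ∑ j, (lapMode G w j ⬝ᵥ centering V *ᵥ N.x τ v t ω) ^ 2 :=
    funext (N.outputSq_eq_sum t)
  rw [this]
  exact integrable_finsetSum _ fun j _ => N.integrable_sq_centered_mode hG hw hτ hv j ht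

variable (G w) in
/-- The contribution of a unit noise entering through `b` to the stationary variance of the
output. -/
noncomputable def channelGain (b : V → ℝ) (τ : ℝ) : ℝ :=
  ∑ j, (lapMode G w j ⬝ᵥ centering V *ᵥ b) ^ 2 * modalGain (lapEigenvalue G w j) τ

theorem tendsto_integral_outputSq (hG : G.Connected) (hw : ∀ e ∈ G.edgeSet, 0 < w e)
    (hτ : τ ∈ stabilityRegion G w) (hv : ∀ k, 0 ≤ v k) :
    Tendsto (fun t => ∫ ω, N.outputSq τ v t ω ∂N.P) atTop
      (𝓝 (∑ k, v k * channelGain G w (fun a => B a k) τ)) := by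
  have hmode : ∀ j, Tendsto
      (fun t => ∫ ω, (lapMode G w j ⬝ᵥ centering V *ᵥ N.x τ v t ω) ^ 2 ∂N.P) atTop
      (𝓝 ((∑ k, v k * (lapMode G w j ⬝ᵥ centering V *ᵥ fun a => B a k) ^ 2)
        * modalGain (lapEigenvalue G w j) τ)) := by
    intro j
    by_cases hj : lapEigenvalue G w j = 0
    · simp [lapMode_dotProduct_centering_of_eq_zero hG hw hj]
    · simp_rw [lapMode_dotProduct_centering_of_ne_zero hj]
      refine N.tendsto_integral_sq_mode hτ.1 hv
        (lt_of_le_of_ne (lapEigenvalue_nonneg hw j) (Ne.symm hj)) ?_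
      rw [mul_comm]
      exact hτ.2 j
  have hsum := tendsto_finsetSum Finset.univ fun j _ => hmode j
  have hval : ∑ j, (∑ k, v k * (lapMode G w j ⬝ᵥ centering V *ᵥ fun a => B a k) ^ 2)
        * modalGain (lapEigenvalue G w j) τ = ∑ k, v k * channelGain G w (fun a => B a k) τ := by
    simp only [channelGain, Finset.sum_mul, Finset.mul_sum]
    rw [Finset.sum_comm]
    exact Finset.sum_congr rfl fun k _ => Finset.sum_congr rfl fun j _ => by ring
  rw [hval] at hsum
  refine hsum.congr' ?_
  filter_upwards [eventually_ge_atTop 0] with t ht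
  simp_rw [N.outputSq_eq_sum]
  rw [integral_finsetSum _ fun j _ => N.integrable_sq_centered_mode hG hw hτ.1 hv j ht]

theorem performance_eq (hG : G.Connected) (hw : ∀ e ∈ G.edgeSet, 0 < w e)
    (hτ : τ ∈ stabilityRegion G w) (hv : ∀ k, 0 ≤ v k) :
    N.performance τ v = ∑ k, v k * channelGain G w (fun a => B a k) τ :=
  (N.tendsto_integral_outputSq hG hw hτ hv).limUnder_eq

/-- The performance is affine in one variance, but the formula is known only for nonnegative
variances, hence the derivative within `Set.Ici 0`. -/
theorem hasDerivWithinAt_performance (hG : G.Connected) (hw : ∀ e ∈ G.edgeSet, 0 < w e)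
    (hτ : τ ∈ stabilityRegion G w) (hv : ∀ k, 0 ≤ v k) (k : K) :
    HasDerivWithinAt (fun s => N.performance τ (Function.update v k s))
      (channelGain G w (fun a => B a k) τ) (Set.Ici 0) (v k) := by
  have hperf : ∀ s ∈ Set.Ici (0 : ℝ), N.performance τ (Function.update v k s)
      = ∑ l, v l * channelGain G w (fun a => B a l) τ
        + (s - v k) * channelGain G w (fun a => B a k) τ := by
    intro s hs
    rw [N.performance_eq hG hw hτ fun l => by
      by_cases h : l = k
      · subst h; simpa using hs
      · simpa [h] using hv l]
    have h1 : ∀ l, Function.update v k s l * channelGain G w (fun a => B a l) τ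
        = v l * channelGain G w (fun a => B a l) τ
          + if l = k then (s - v k) * channelGain G w (fun a => B a k) τ else 0 := by
      intro l
      by_cases h : l = k
      · subst h; simp; ring
      · simp [h]
    simp_rw [h1, Finset.sum_add_distrib]
    simp
  have h2 : HasDerivWithinAt (fun s => ∑ l, v l * channelGain G w (fun a => B a l) τ
      + (s - v k) * channelGain G w (fun a => B a k) τ)
      (channelGain G w (fun a => B a k) τ) (Set.Ici 0) (v k) := by
    simpa using ((((hasDerivAt_id (v k)).sub_const (v k)).mul_const
      (channelGain G w (fun a => B a k) τ)).const_add
      (∑ l, v l * channelGain G w (fun a => B a l) τ)).hasDerivWithinAt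
  exact h2.congr hperf (hperf _ (hv k))

theorem centrality_eq (hG : G.Connected) (hw : ∀ e ∈ G.edgeSet, 0 < w e)
    (hτ : τ ∈ stabilityRegion G w) (hv : ∀ k, 0 ≤ v k) (k : K) :
    N.centrality k v τ = channelGain G w (fun a => B a k) τ :=
  (N.hasDerivWithinAt_performance hG hw hτ hv k).derivWithin
    (uniqueDiffOn_Ici 0 _ (hv k))

theorem wellPosed (hG : G.Connected) (hw : ∀ e ∈ G.edgeSet, 0 < w e)
    (hτ : τ ∈ stabilityRegion G w) (hv : ∀ k, 0 ≤ v k) : N.WellPosed τ v where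
  integrable _ ht := N.integrable_outputSq hG hw hτ.1 hv ht
  tendsto := by
    rw [N.performance_eq hG hw hτ hv]
    exact N.tendsto_integral_outputSq hG hw hτ hv
  differentiable k := (N.hasDerivWithinAt_performance hG hw hτ hv k).differentiableWithinAt

end Connected

end NoisyNetwork

/-! ### The stability region -/

section Region

open Matrix

/-- The columns of the link noise matrices `E W` and `-E` are not constant. -/
theorem exists_ne_of_link_noise {V : Type*} [DecidableEq V] {G : SimpleGraph V}
    {w : Sym2 V → ℝ} (hw : ∀ e ∈ G.edgeSet, 0 < w e) {hd tl : G.edgeSet → V}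
    (hor : ∀ e : G.edgeSet, s(hd e, tl e) = (e : Sym2 V)) {B : Matrix V G.edgeSet ℝ}
    [Fintype G.edgeSet]
    (hB : B = incidence G hd tl * weightMat G w ∨ B = -incidence G hd tl) (e : G.edgeSet) :
    ∃ a b, B a e ≠ B b e := by
  have hne : tl e ≠ hd e := by
    have h1 : s(hd e, tl e) ∈ G.edgeSet := by rw [hor]; exact e.2
    exact (G.mem_edgeSet.1 h1).ne'
  refine ⟨hd e, tl e, ?_⟩
  rcases hB with rfl | rfl
  · have := hw _ e.2
    rw [weightMat, mul_diagonal, mul_diagonal]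
    simp only [incidence, of_apply, if_true, if_neg hne]
    intro h
    linarith
  · simp only [incidence, Matrix.neg_apply, of_apply, if_true, if_neg hne]
    norm_num

theorem exists_wAdj_pos {V : Type*} [Nontrivial V] {G : SimpleGraph V} [DecidableRel G.Adj]
    {w : Sym2 V → ℝ} (hG : G.Connected) (hw : ∀ e ∈ G.edgeSet, 0 < w e)
    (i : V) : ∃ j, j ≠ i ∧ 0 < wAdj G w i j := by
  obtain ⟨j, hj⟩ := hG.preconnected.exists_adj_of_nontrivial i
  exact ⟨j, hj.ne', by simpa [wAdj, hj] using hw _ (G.mem_edgeSet.2 hj)⟩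

variable {V : Type*} [Fintype V] [DecidableEq V]
  {G : SimpleGraph V} [DecidableRel G.Adj] {w : Sym2 V → ℝ} {τ : ℝ}

/-- Openness relative to `[0, ∞)` lets the closed formula for an index be differentiated, including
from the right at 0. -/
theorem stabilityRegion_mem_nhdsWithin (hτ : τ ∈ stabilityRegion G w) :
    stabilityRegion G w ∈ 𝓝[Set.Ici 0] τ := by
  have h1 : ∀ᶠ t in 𝓝 τ, ∀ j, t * (wLap_isHermitian G w).eigenvalues j < Real.pi / 2 := by
    refine eventually_all.2 fun j => ?_
    exact (continuous_mul_const _).continuousAt.eventually_lt_const (hτ.2 j)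
  filter_upwards [self_mem_nhdsWithin, nhdsWithin_le_nhds h1] with t h0 ht
  exact ⟨h0, ht⟩

theorem convex_stabilityRegion (hw : ∀ e ∈ G.edgeSet, 0 < w e) :
    Convex ℝ (stabilityRegion G w) := by
  refine Set.OrdConnected.convex ⟨fun a ha b hb t ht => ⟨ha.1.trans ht.1, fun j => ?_⟩⟩
  exact (mul_le_mul_of_nonneg_right ht.2 (lapEigenvalue_nonneg hw j)).trans_lt (hb.2 j)

theorem sin_lapEigenvalue_mul_lt_one (hw : ∀ e ∈ G.edgeSet, 0 < w e)
    (hτ : τ ∈ stabilityRegion G w) (j : V) : Real.sin (lapEigenvalue G w j * τ) < 1 := by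
  refine sin_lt_one_of_mem (mul_nonneg (lapEigenvalue_nonneg hw j) hτ.1) ?_
  rw [mul_comm]
  exact hτ.2 j

theorem spectralSlope_eq (b : V → ℝ) : spectralSlope G w b τ
    = 1 / 2 * ∑ j, (lapMode G w j ⬝ᵥ centering V *ᵥ b) ^ 2
      / (1 - Real.sin (lapEigenvalue G w j * τ)) := rfl

theorem spectralSlope_nonneg (hw : ∀ e ∈ G.edgeSet, 0 < w e)
    (hτ : τ ∈ stabilityRegion G w) (b : V → ℝ) : 0 ≤ spectralSlope G w b τ := by
  rw [spectralSlope_eq]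
  refine mul_nonneg (by norm_num) (Finset.sum_nonneg fun j _ => div_nonneg (sq_nonneg _) ?_)
  linarith [sin_lapEigenvalue_mul_lt_one hw hτ j]

theorem spectralSlope_pos (hw : ∀ e ∈ G.edgeSet, 0 < w e)
    (hτ : τ ∈ stabilityRegion G w) {b : V → ℝ} {i i' : V} (hb : b i ≠ b i') :
    0 < spectralSlope G w b τ := by
  have hs := fun j => sub_pos.2 (sin_lapEigenvalue_mul_lt_one hw hτ j)
  obtain ⟨j, hj⟩ := exists_lapMode_dotProduct_centering_ne_zero (G := G) (w := w) hb
  rw [spectralSlope_eq]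
  refine mul_pos (by norm_num) (Finset.sum_pos' (fun j _ => div_nonneg (sq_nonneg _) (hs j).le)
    ⟨j, Finset.mem_univ j, div_pos ?_ (hs j)⟩)
  positivity

theorem hasDerivAt_channelGain (hG : G.Connected) (hw : ∀ e ∈ G.edgeSet, 0 < w e)
    (hτ : τ ∈ stabilityRegion G w) (b : V → ℝ) :
    HasDerivAt (NoisyNetwork.channelGain G w b) (spectralSlope G w b τ) τ := by
  have := hG.nonempty
  unfold NoisyNetwork.channelGain
  rw [spectralSlope_eq, Finset.mul_sum]
  refine HasDerivAt.fun_sum fun j _ => ?_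
  -- For a zero eigenvalue the weight vanishes, so the value that `modalGain` takes from division by
  -- zero is harmless.
  by_cases hj : lapEigenvalue G w j = 0
  · rw [lapMode_dotProduct_centering_of_eq_zero hG hw hj]
    simpa using hasDerivAt_const τ (0 : ℝ)
  · refine ((hasDerivAt_modalGain hj (sin_lapEigenvalue_mul_lt_one hw hτ j)).const_mul
      _).congr_deriv ?_
    ring

theorem wDeg_diag_pos [Nontrivial V] (hG : G.Connected) (hw : ∀ e ∈ G.edgeSet, 0 < w e)
    (i : V) : 0 < wDeg G w i i := by
  obtain ⟨j, -, hj⟩ := exists_wAdj_pos hG hw i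
  rw [wDeg, diagonal_apply_eq]
  exact Finset.sum_pos' (fun k _ => wAdj_nonneg hw i k) ⟨j, Finset.mem_univ j, hj⟩

/-- The columns of the node noise matrices `1`, `L`, `Δ`, `A` are not constant. -/
theorem exists_ne_of_node_noise [Nontrivial V] (hG : G.Connected)
    (hw : ∀ e ∈ G.edgeSet, 0 < w e) {B : Matrix V V ℝ}
    (hB : B = 1 ∨ B = wLap G w ∨ B = wDeg G w ∨ B = wAdj G w) (i : V) :
    ∃ a b, B a i ≠ B b i := by
  obtain ⟨j, hji, hj⟩ := exists_wAdj_pos hG hw i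
  have hdeg := wDeg_diag_pos hG hw i
  have hdeg0 : wDeg G w j i = 0 := by rw [wDeg, diagonal_apply_ne _ hji]
  have hadj0 : wAdj G w i i = 0 := by simp [wAdj]
  rw [wAdj_symm] at hj
  -- Compare the diagonal entry with that of a neighbour `j`: for `1`, `L` and `Δ` only the diagonal
  -- entry is positive, for `A` only the other one.
  refine ⟨i, j, ?_⟩
  rcases hB with rfl | rfl | rfl | rfl
  · simp [one_apply, hji]
  · rw [wLap, Matrix.sub_apply, Matrix.sub_apply, hdeg0, hadj0]
    intro h
    linarith
  · rw [hdeg0]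
    exact hdeg.ne'
  · rw [hadj0]
    exact hj.ne

end Region

/-! ### Monotonicity of the indices in the delay. -/

namespace NoisyNetwork

variable {V K : Type*} [Fintype V] [DecidableEq V] [Fintype K] [DecidableEq K]
  {G : SimpleGraph V} [DecidableRel G.Adj] {w : Sym2 V → ℝ} {B : Matrix V K ℝ}
  (N : NoisyNetwork.{u} (wLap G w) B) {τ : ℝ} {v : K → ℝ}

theorem hasDerivWithinAt_centrality (hG : G.Connected) (hw : ∀ e ∈ G.edgeSet, 0 < w e)
    (hτ : τ ∈ stabilityRegion G w) (hv : ∀ k, 0 ≤ v k) (k : K) :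
    HasDerivWithinAt (N.centrality k v) (spectralSlope G w (fun a => B a k) τ) (Set.Ici 0) τ := by
  have := hG.nonempty
  refine (hasDerivAt_channelGain hG hw hτ _).hasDerivWithinAt.congr_of_eventuallyEq ?_
    (N.centrality_eq hG hw hτ hv k)
  filter_upwards [stabilityRegion_mem_nhdsWithin hτ] with t ht
  exact N.centrality_eq hG hw ht hv k

theorem hasDerivWithinAt_centrality_interior (hG : G.Connected)
    (hw : ∀ e ∈ G.edgeSet, 0 < w e) (hv : ∀ k, 0 ≤ v k) (k : K) :
    ∀ τ ∈ interior (stabilityRegion G w), HasDerivWithinAt (N.centrality k v)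
      (spectralSlope G w (fun a => B a k) τ) (interior (stabilityRegion G w)) τ := fun _ hτ =>
  (N.hasDerivWithinAt_centrality hG hw (interior_subset hτ) hv k).mono
    fun _ ht => (interior_subset ht).1

theorem continuousOn_centrality (hG : G.Connected) (hw : ∀ e ∈ G.edgeSet, 0 < w e)
    (hv : ∀ k, 0 ≤ v k) (k : K) : ContinuousOn (N.centrality k v) (stabilityRegion G w) :=
  fun _ hτ => (N.hasDerivWithinAt_centrality hG hw hτ hv k).continuousWithinAt.mono
    fun _ ht => ht.1

theorem monotoneOn_centrality (hG : G.Connected) (hw : ∀ e ∈ G.edgeSet, 0 < w e)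
    (hv : ∀ k, 0 ≤ v k) (k : K) : MonotoneOn (N.centrality k v) (stabilityRegion G w) :=
  monotoneOn_of_hasDerivWithinAt_nonneg (convex_stabilityRegion hw)
    (N.continuousOn_centrality hG hw hv k) (N.hasDerivWithinAt_centrality_interior hG hw hv k)
    fun _ hτ => spectralSlope_nonneg hw (interior_subset hτ) _

theorem strictMonoOn_centrality (hG : G.Connected) (hw : ∀ e ∈ G.edgeSet, 0 < w e)
    (hv : ∀ k, 0 ≤ v k) {k : K} (hB : ∃ a b, B a k ≠ B b k) :
    StrictMonoOn (N.centrality k v) (stabilityRegion G w) := by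
  obtain ⟨a, b, hab⟩ := hB
  exact strictMonoOn_of_hasDerivWithinAt_pos (convex_stabilityRegion hw)
    (N.continuousOn_centrality hG hw hv k) (N.hasDerivWithinAt_centrality_interior hG hw hv k)
    fun _ hτ => spectralSlope_pos hw (interior_subset hτ) hab

end NoisyNetwork

theorem theorem1 {V : Type*} [Fintype V] [DecidableEq V] [Nontrivial V]
    (G : SimpleGraph V) [DecidableRel G.Adj] (hG : G.Connected)
    (w : Sym2 V → ℝ) (hw : ∀ e ∈ G.edgeSet, 0 < w e)
    (hd tl : G.edgeSet → V) (hor : ∀ e : G.edgeSet, s(hd e, tl e) = (e : Sym2 V)) :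
    -- node noise: the indices `η_i`
    (∀ (B : Matrix V V ℝ) (N : NoisyNetwork.{u} (wLap G w) B) (v : V → ℝ), (∀ k, 0 ≤ v k) →
      (∀ τ ∈ stabilityRegion G w, N.WellPosed τ v) ∧
      ∀ i : V,
        (∀ τ ∈ stabilityRegion G w, HasDerivWithinAt (N.centrality i v)
          (spectralSlope G w (fun a => B a i) τ) (Set.Ici 0) τ) ∧
        MonotoneOn (N.centrality i v) (stabilityRegion G w) ∧
        ((∃ a b, B a i ≠ B b i) ∨ B = 1 ∨ B = wLap G w ∨ B = wDeg G w ∨ B = wAdj G w →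
          (∀ τ ∈ stabilityRegion G w, 0 < spectralSlope G w (fun a => B a i) τ) ∧
          StrictMonoOn (N.centrality i v) (stabilityRegion G w))) ∧
    -- link noise: the indices `ν_e`
    (∀ (B : Matrix V G.edgeSet ℝ) (N : NoisyNetwork.{u} (wLap G w) B) (v : G.edgeSet → ℝ),
      (∀ k, 0 ≤ v k) →
      (∀ τ ∈ stabilityRegion G w, N.WellPosed τ v) ∧
      ∀ e : G.edgeSet,
        (∀ τ ∈ stabilityRegion G w, HasDerivWithinAt (N.centrality e v)
          (spectralSlope G w (fun a => B a e) τ) (Set.Ici 0) τ) ∧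
        MonotoneOn (N.centrality e v) (stabilityRegion G w) ∧
        ((∃ a b, B a e ≠ B b e) ∨ B = incidence G hd tl * weightMat G w ∨
            B = -incidence G hd tl →
          (∀ τ ∈ stabilityRegion G w, 0 < spectralSlope G w (fun a => B a e) τ) ∧
          StrictMonoOn (N.centrality e v) (stabilityRegion G w))) := by
  have := hG.nonempty
  refine ⟨fun B N v hv => ⟨fun τ hτ => N.wellPosed hG hw hτ hv, fun i =>
      ⟨fun τ hτ => N.hasDerivWithinAt_centrality hG hw hτ hv i,
        N.monotoneOn_centrality hG hw hv i, fun hB => ?_⟩⟩,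
    fun B N v hv => ⟨fun τ hτ => N.wellPosed hG hw hτ hv, fun e =>
      ⟨fun τ hτ => N.hasDerivWithinAt_centrality hG hw hτ hv e,
        N.monotoneOn_centrality hG hw hv e, fun hB => ?_⟩⟩⟩
  · have hne : ∃ a b, B a i ≠ B b i := hB.elim id (exists_ne_of_node_noise hG hw · i)
    obtain ⟨a, b, hab⟩ := hne
    exact ⟨fun τ hτ => spectralSlope_pos hw hτ hab, N.strictMonoOn_centrality hG hw hv ⟨a, b, hab⟩⟩
  · have hne : ∃ a b, B a e ≠ B b e := hB.elim id (exists_ne_of_link_noise hw hor · e)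
    obtain ⟨a, b, hab⟩ := hne
    exact ⟨fun τ hτ => spectralSlope_pos hw hτ hab, N.strictMonoOn_centrality hG hw hv ⟨a, b, hab⟩⟩
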